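/- Let $C$ (customer types) and $S$ (server types) be non-empty finite sets and let $E\subset C\times S$ be such that the bipartite graph $(C,S,E)$ is connected. For $c\in C$, $s\in S$ put $S(c)=\{t:(c,t)\in E\}$ and $C(s)=\{d:(d,s)\in E\}$; for $U\subset C$, $V\subset S$ put $S(U)=\bigcup_{c\in U}S(c)$ and $C(V)=\bigcup_{s\in V}C(s)$. The states of the buffer are the elements of $$\mathcal E=\Bigl\{(x,y)\in\mathbb N^C\times\mathbb N^S:\ \sum_{c}x_c=\sum_{s}y_s,\ \ x_cy_s=0\ \text{for all }(c,s)\in E\Bigr\}.$$ At each time step a pair $(c,s)$ arrives; the arrivals are i.i.d. with law $\mu$, a probability measure on $C\times S$ whose marginals $\mu_C$ and $\mu_S$ have full support $C$ and $S$. Under the Match-the-Longest policy (ML), if $x_i>0$ for some $i\in C(s)$, then the server $s$ leaves together with a customer whose type $\Phi$ is uniformly distributed on $\arg\max\{x_i:i\in C(s)\}$; likewise, if $y_j>0$ for some $j\in S(c)$, then the customer $c$ leaves together with a server whose type $\Psi$ is uniformly distributed on $\arg\max\{y_j:j\in S(c)\}$ (the two choices being independent of each other, given the state and the arrival, and of the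 past). If exactly one of $c$, $s$ is matched in this way, the other one is added to the buffer. If neither is, then $c$ and $s$ leave together when $(c,s)\in E$, and both are added to the buffer when $(c,s)\notin E$. Let $P_\mu$ be the transition matrix of the resulting Markov chain on $\mathcal E$. The model is called *stable* if this chain has a unique stationary probability measure $\pi$ and $\pi$ is attractive, that is, for every probability measure $\nu$ on $\mathcal E$ the Cesàro averages of $(\nu P_\mu^n)_{n\ge 0}$ converge weakly to $\pi$. **Theorem.** For every connected bipartite graph $(C,S,E)$ the ML policy has a maximal stability region: for every probability measure $\mu$ on $C\times S$ whose marginals have full support, the model is stable if and only if $$\mu_C(U)<\mu_S(S(U))\quad\text{for all }\emptyset\neq U\subsetneq C,\qquad \mu_S(V)<\mu_C(C(V))\quad\text{for all }\emptyset\neq V\subsetneq S.$$ -/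

import Mathlib

open scoped Topology

noncomputable section

namespace BipartiteMatching

/-! ### Markov chains with a transition matrix given by its rows, as probability mass functions -/

/-- `π P = π`. -/
def IsStationary {X : Type*} (P : X → PMF X) (π : PMF X) : Prop :=
  π.bind P = π

/-- The law `ν Pⁿ` of the chain at time `n`, for the initial law `ν`. -/
def lawAt {X : Type*} (P : X → PMF X) (ν : PMF X) (n : ℕ) : PMF X :=
  (fun ρ => ρ.bind P)^[n] ν

/-- The Cesàro average `(ν + ν P + ⋯ + ν Pⁿ) / (n + 1)`, written as the uniform mixture of the laws
at the times `0, …, n`. -/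
def cesaro {X : Type*} (P : X → PMF X) (ν : PMF X) (n : ℕ) : PMF X :=
  (PMF.uniformOfFintype (Fin (n + 1))).bind fun k => lawAt P ν k

/-- A probability mass function as a probability measure. -/
def toProbabilityMeasure {X : Type*} [MeasurableSpace X] (ρ : PMF X) :
    MeasureTheory.ProbabilityMeasure X :=
  ⟨ρ.toMeasure, PMF.toMeasure.isProbabilityMeasure ρ⟩

/-- `π` is attractive: for every initial law `ν`, the Cesàro averages of `ν Pⁿ` converge weakly
to `π`. -/
def IsAttractive {X : Type*} [TopologicalSpace X] [MeasurableSpace X] [OpensMeasurableSpace X]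
    (P : X → PMF X) (π : PMF X) : Prop :=
  ∀ ν : PMF X, Filter.Tendsto (fun n => toProbabilityMeasure (cesaro P ν n)) Filter.atTop
    (𝓝 (toProbabilityMeasure π))

/-- The chain has a unique stationary probability measure, and this measure is attractive. -/
def IsStable {X : Type*} [TopologicalSpace X] [MeasurableSpace X] [OpensMeasurableSpace X]
    (P : X → PMF X) : Prop :=
  ∃ π : PMF X, IsStationary P π ∧ (∀ π', IsStationary P π' → π' = π) ∧ IsAttractive P π

/-! ### The matching graph and the state space -/

section Model

variable {C S : Type*}

/-- The bipartite graph `(C, S, E)`, as an undirected graph on the disjoint union of `C` and `S`. -/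
def matchingGraph (E : Set (C × S)) : SimpleGraph (C ⊕ S) :=
  SimpleGraph.fromRel fun a b => ∃ c s, (c, s) ∈ E ∧ a = Sum.inl c ∧ b = Sum.inr s

variable [Fintype C] [Fintype S]

/-- The commutative state space: `x c` customers of type `c` and `y s` servers of type `s`, as many
customers as servers, and no two of them that can be matched. Its topology and its σ-algebra are
those induced from the product of copies of `ℕ`, hence discrete. -/
abbrev State (E : Set (C × S)) : Type _ :=
  {z : (C → ℕ) × (S → ℕ) // ∑ c, z.1 c = ∑ s, z.2 s ∧ ∀ c s, (c, s) ∈ E → z.1 c * z.2 s = 0}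

/-- The customer types that are present in `x` and can be matched with an `s`-server. -/
abbrev AvailableCustomers (E : Set (C × S)) (x : C → ℕ) (s : S) : Type _ :=
  {c : C // (c, s) ∈ E ∧ 0 < x c}

/-- The server types that are present in `y` and can be matched with a `c`-customer. -/
abbrev AvailableServers (E : Set (C × S)) (y : S → ℕ) (c : C) : Type _ :=
  {s : S // (c, s) ∈ E ∧ 0 < y s}

/-- An admissible (possibly randomized) matching policy on the commutative state space, given by the
laws of the random choices `Φ(x, s)` and `Ψ(y, c)`, made when there is something to choose. -/
structure Policy (E : Set (C × S)) where
  Φ : ∀ (x : C → ℕ) (s : S), Nonempty (AvailableCustomers E x s) → PMF (AvailableCustomers E x s)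
  Ψ : ∀ (y : S → ℕ) (c : C), Nonempty (AvailableServers E y c) → PMF (AvailableServers E y c)

open Classical in
/-- One more individual of type `a`. -/
def addOne {A : Type*} (x : A → ℕ) (a : A) : A → ℕ := x + Pi.single a 1

open Classical in
/-- One individual of type `a` less; only used when `0 < x a`. -/
def removeOne {A : Type*} (x : A → ℕ) (a : A) : A → ℕ := x - Pi.single a 1

theorem sum_addOne {A : Type*} [Fintype A] (x : A → ℕ) (a : A) :
    ∑ i, addOne x a i = ∑ i, x i + 1 := by
  classical
  simp [addOne, Finset.sum_add_distrib, Pi.single_apply]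

theorem addOne_removeOne {A : Type*} (x : A → ℕ) (a : A) (h : 0 < x a) :
    addOne (removeOne x a) a = x := by
  classical
  funext i
  by_cases hi : i = a
  · subst hi
    simp [addOne, removeOne]
    omega
  · simp [addOne, removeOne, hi]

theorem sum_removeOne {A : Type*} [Fintype A] (x : A → ℕ) (a : A) (h : 0 < x a) :
    ∑ i, removeOne x a i + 1 = ∑ i, x i := by
  rw [← sum_addOne (removeOne x a) a, addOne_removeOne x a h]

theorem removeOne_le {A : Type*} (x : A → ℕ) (a i : A) : removeOne x a i ≤ x i := by
  simp [removeOne]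

theorem addOne_of_ne {A : Type*} (x : A → ℕ) {a i : A} (h : i ≠ a) : addOne x a i = x i := by
  classical
  simp [addOne, h]

/-- Neither the new customer nor the new server finds a match, and they do not match each other. -/
def State.add {E : Set (C × S)} (z : State E) (c : C) (s : S) (hE : (c, s) ∉ E)
    (hs : ¬ Nonempty (AvailableCustomers E z.1.1 s))
    (hc : ¬ Nonempty (AvailableServers E z.1.2 c)) : State E :=
  ⟨(addOne z.1.1 c, addOne z.1.2 s), by
    refine ⟨by simp only [sum_addOne, z.2.1], fun d t hdt => ?_⟩
    simp only [nonempty_subtype, not_exists, not_and, not_lt, Nat.le_zero] at hs hc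
    have h0 := z.2.2 d t hdt
    by_cases hd : d = c
    · subst hd
      have ht : t ≠ s := fun h => hE (h ▸ hdt)
      simp [addOne_of_ne _ ht, hc t hdt]
    · by_cases ht : t = s
      · subst ht
        simp [addOne_of_ne _ hd, hs d hdt]
      · simpa [addOne_of_ne _ hd, addOne_of_ne _ ht] using h0⟩

/-- The new server leaves with a customer `i` and the new customer with a server `j`. -/
def State.removeBoth {E : Set (C × S)} (z : State E) {c : C} {s : S}
    (i : AvailableCustomers E z.1.1 s) (j : AvailableServers E z.1.2 c) : State E :=
  ⟨(removeOne z.1.1 i, removeOne z.1.2 j), by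
    refine ⟨?_, fun d t hdt => ?_⟩
    · have h1 := sum_removeOne z.1.1 i i.2.2
      have h2 := sum_removeOne z.1.2 j j.2.2
      have h3 := z.2.1
      simp only
      omega
    · exact Nat.le_zero.1 ((Nat.mul_le_mul (removeOne_le _ _ _) (removeOne_le _ _ _)).trans
        (z.2.2 d t hdt).le)⟩

/-- The new server leaves with a customer `i`, and the new customer `c` is put into the buffer. -/
def State.replaceCustomer {E : Set (C × S)} (z : State E) {s : S}
    (i : AvailableCustomers E z.1.1 s) (c : C)
    (hc : ¬ Nonempty (AvailableServers E z.1.2 c)) : State E :=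
  ⟨(addOne (removeOne z.1.1 i) c, z.1.2), by
    refine ⟨?_, fun d t hdt => ?_⟩
    · simp only [sum_addOne, sum_removeOne z.1.1 i i.2.2, z.2.1]
    · simp only [nonempty_subtype, not_exists, not_and, not_lt, Nat.le_zero] at hc
      by_cases hd : d = c
      · subst hd
        simp [hc t hdt]
      · simp only [addOne_of_ne _ hd]
        exact Nat.le_zero.1 ((Nat.mul_le_mul_right _ (removeOne_le _ _ _)).trans
          (z.2.2 d t hdt).le)⟩

/-- The new customer leaves with a server `j`, and the new server `s` is put into the buffer. -/
def State.replaceServer {E : Set (C × S)} (z : State E) {c : C}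
    (j : AvailableServers E z.1.2 c) (s : S)
    (hs : ¬ Nonempty (AvailableCustomers E z.1.1 s)) : State E :=
  ⟨(z.1.1, addOne (removeOne z.1.2 j) s), by
    refine ⟨?_, fun d t hdt => ?_⟩
    · simp only [sum_addOne, sum_removeOne z.1.2 j j.2.2, z.2.1]
    · simp only [nonempty_subtype, not_exists, not_and, not_lt, Nat.le_zero] at hs
      by_cases ht : t = s
      · subst ht
        simp [hs d hdt]
      · simp only [addOne_of_ne _ ht]
        exact Nat.le_zero.1 ((Nat.mul_le_mul_left _ (removeOne_le _ _ _)).trans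
          (z.2.2 d t hdt).le)⟩

/-! ### The dynamics -/

open Classical in
/-- The law of the new state `(x, y) ⊙ (c, s)`. Individuals already in the buffer have priority, and
the two choices are independent. -/
def Policy.step {E : Set (C × S)} (pol : Policy E) (z : State E) (a : C × S) : PMF (State E) :=
  if hs : Nonempty (AvailableCustomers E z.1.1 a.2) then
    if hc : Nonempty (AvailableServers E z.1.2 a.1) then
      (pol.Φ z.1.1 a.2 hs).bind fun i => (pol.Ψ z.1.2 a.1 hc).map fun j => z.removeBoth i j
    else
      (pol.Φ z.1.1 a.2 hs).map fun i => z.replaceCustomer i a.1 hc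
  else
    if hc : Nonempty (AvailableServers E z.1.2 a.1) then
      (pol.Ψ z.1.2 a.1 hc).map fun j => z.replaceServer j a.2 hs
    else
      if hE : (a.1, a.2) ∈ E then PMF.pure z
      else PMF.pure (z.add a.1 a.2 hE hs hc)

/-- The transition matrix of the buffer content, when the successive arrivals are independent with
law `μ`. -/
def Policy.chain {E : Set (C × S)} (pol : Policy E) (μ : PMF (C × S)) (z : State E) :
    PMF (State E) :=
  μ.bind fun a => pol.step z a

/-! ### Match the Longest -/

open Classical in
/-- The maximizers of `x` over the customer types that can be matched with an `s`-server. -/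
def longestCustomers (E : Set (C × S)) (x : C → ℕ) (s : S) : Finset (AvailableCustomers E x s) :=
  {i | ∀ d, (d, s) ∈ E → x d ≤ x i}

open Classical in
/-- The maximizers of `y` over the server types that can be matched with a `c`-customer. -/
def longestServers (E : Set (C × S)) (y : S → ℕ) (c : C) : Finset (AvailableServers E y c) :=
  {j | ∀ t, (c, t) ∈ E → y t ≤ y j}

theorem longestCustomers_nonempty (E : Set (C × S)) (x : C → ℕ) (s : S)
    (h : Nonempty (AvailableCustomers E x s)) : (longestCustomers E x s).Nonempty := by
  classical
  obtain ⟨i, hi⟩ := Finite.exists_max fun i : AvailableCustomers E x s => x i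
  refine ⟨i, ?_⟩
  simp only [longestCustomers, Finset.mem_filter, Finset.mem_univ, true_and]
  intro d hd
  by_cases h0 : 0 < x d
  · exact hi ⟨d, hd, h0⟩
  · omega

theorem longestServers_nonempty (E : Set (C × S)) (y : S → ℕ) (c : C)
    (h : Nonempty (AvailableServers E y c)) : (longestServers E y c).Nonempty := by
  classical
  obtain ⟨j, hj⟩ := Finite.exists_max fun j : AvailableServers E y c => y j
  refine ⟨j, ?_⟩
  simp only [longestServers, Finset.mem_filter, Finset.mem_univ, true_and]
  intro t ht
  by_cases h0 : 0 < y t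
  · exact hj ⟨t, ht, h0⟩
  · omega

/-- The policy ML: the choices are uniform among the types with the longest queue. -/
def matchTheLongest (E : Set (C × S)) : Policy E where
  Φ x s h := PMF.uniformOfFinset (longestCustomers E x s) (longestCustomers_nonempty E x s h)
  Ψ y c h := PMF.uniformOfFinset (longestServers E y c) (longestServers_nonempty E y c h)

/-! ### Stability regions -/

open Classical in
/-- `S(U)`, the set of server types that can be matched with some customer type of `U`. -/
def serversOf (E : Set (C × S)) (U : Finset C) : Finset S :=
  {s | ∃ c ∈ U, (c, s) ∈ E}

open Classical in
/-- `C(V)`, the set of customer types that can be matched with some server type of `V`. -/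
def customersOf (E : Set (C × S)) (V : Finset S) : Finset C :=
  {c | ∃ s ∈ V, (c, s) ∈ E}

/-- The conditions NCond on a law `p` on `C` and a law `q` on `S`, over the non-empty proper
subsets. -/
def NCond (E : Set (C × S)) (p : PMF C) (q : PMF S) : Prop :=
  (∀ U : Finset C, U.Nonempty → U ≠ Finset.univ → ∑ c ∈ U, p c < ∑ s ∈ serversOf E U, q s) ∧
  (∀ V : Finset S, V.Nonempty → V ≠ Finset.univ → ∑ s ∈ V, q s < ∑ c ∈ customersOf E V, p c)

/-- Each type of customer and each type of server arrives with positive probability. -/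
def HasFullMarginals (μ : PMF (C × S)) : Prop :=
  (μ.map Prod.fst).support = Set.univ ∧ (μ.map Prod.snd).support = Set.univ

/-- The arrival laws for which the model is stable. -/
def Policy.stabilityRegion {E : Set (C × S)} (pol : Policy E) : Set (PMF (C × S)) :=
  {μ | HasFullMarginals μ ∧ IsStable (pol.chain μ)}

/-- The arrival laws whose marginals satisfy NCond. -/
def ncondRegion (E : Set (C × S)) : Set (PMF (C × S)) :=
  {μ | HasFullMarginals μ ∧ NCond E (μ.map Prod.fst) (μ.map Prod.snd)}

/-- The stability region is all of the region defined by NCond. -/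
def Policy.HasMaximalStabilityRegion {E : Set (C × S)} (pol : Policy E) : Prop :=
  pol.stabilityRegion = ncondRegion E

end Model

end BipartiteMatching

end

/-! Necessity holds for every policy. Give customers weights `u` and servers weights `v` with `u c ≤
v s` on edges. In the weighted difference `imbalance u v`, an arrival `(c, s)` contributes `u c - v
s`, and every match along an edge adds a non-negative amount. If the arrivals had non-negative mean
weight, this functional would be a submartingale with bounded increments. Under a stationary law it
would then be constant along trajectories (`eq_of_stationary_submartingale`), so every possible
arrival would have weight zero and the functional would be nondecreasing from every state. If it is
unbounded above, a start high enough never visits a given atom of the stationary law, against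
attractiveness. Indicators of `U` and `S(U)`, or negated indicators of `C(V)` and `V`, give NCond;
when `S(U)` or `C(V)` is everything, full support suffices.

Sufficiency is a Foster argument with the sum of squared queue lengths. Up to a constant, ML lowers
it by twice the longest compatible queue on each side, while an arrival raises it by at most twice
the queue it may join. NCond with a uniform slack, summed over the superlevel sets of the queue
lengths (`sum_mul_le_of_level_sets`), makes the drift at most `-δ * size + 2`
(`exists_energy_drift`). Hence the Cesàro averages are tight and their limit points are stationary
laws. The empty buffer can be reached from every state (`Policy.reachable_emptyState`), so there is
only one stationary law, and all averages converge to it. -/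

open Filter MeasureTheory
open scoped ENNReal

namespace BipartiteMatching

section Chain

variable {X : Type*}

/-! ### Expectations of non-negative functions -/

/-- The expectation of a non-negative function. -/
noncomputable def expect (p : PMF X) (f : X → ℝ≥0∞) : ℝ≥0∞ := ∑' z, p z * f z

theorem expect_pure (z : X) (f : X → ℝ≥0∞) : expect (PMF.pure z) f = f z := by
  classical
  rw [expect, tsum_eq_single z fun w hw => by simp [PMF.pure_apply, hw]]
  simp

theorem expect_bind {Y : Type*} (p : PMF X) (q : X → PMF Y) (f : Y → ℝ≥0∞) :
    expect (p.bind q) f = expect p fun z => expect (q z) f := by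
  simp only [expect, PMF.bind_apply, ← ENNReal.tsum_mul_right, ← ENNReal.tsum_mul_left, mul_assoc]
  exact ENNReal.tsum_comm

theorem expect_map {Y : Type*} (p : PMF X) (g : X → Y) (f : Y → ℝ≥0∞) :
    expect (p.map g) f = expect p fun z => f (g z) := by
  rw [← PMF.bind_pure_comp, expect_bind]
  simp [expect_pure]

theorem expect_mono {p : PMF X} {f g : X → ℝ≥0∞} (h : ∀ z, p z ≠ 0 → f z ≤ g z) :
    expect p f ≤ expect p g := by
  refine ENNReal.tsum_le_tsum fun z => ?_
  by_cases hz : p z = 0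
  · simp [hz]
  · exact mul_le_mul_right (h z hz) _

theorem expect_const (p : PMF X) (c : ℝ≥0∞) : expect p (fun _ => c) = c := by
  rw [expect, ENNReal.tsum_mul_right, p.tsum_coe, one_mul]

theorem expect_add (p : PMF X) (f g : X → ℝ≥0∞) :
    expect p (fun z => f z + g z) = expect p f + expect p g := by
  simp only [expect, mul_add, ENNReal.tsum_add]

theorem expect_const_mul (p : PMF X) (c : ℝ≥0∞) (f : X → ℝ≥0∞) :
    expect p (fun z => c * f z) = c * expect p f := by
  simp only [expect, mul_left_comm _ c, ENNReal.tsum_mul_left]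

/-- Both total masses are 1, so no inequality can be strict. Stationarity can thus be proved by a
one-sided bound. -/
theorem PMF_eq_of_le {p q : PMF X} (h : ∀ z, p z ≤ q z) : p = q := by
  refine PMF.ext fun z => (h z).antisymm (not_lt.1 fun hlt => ?_)
  have := ENNReal.tsum_lt_tsum p.tsum_coe_ne_top h hlt
  simp at this

/-! ### Uniqueness of the stationary law -/

/-- The relation of being linked by a transition of positive probability. -/
def Linked (P : X → PMF X) (z w : X) : Prop := P z w ≠ 0

/-- The invariant weight `r` need not have mass 1: it will be a difference of a stationary law and a
smaller invariant measure. -/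
theorem pos_of_reachable {P : X → PMF X} {r : X → ℝ≥0∞} (hr : ∀ w, ∑' z, r z * P z w = r w)
    {z w : X} (h : Relation.ReflTransGen (Linked P) z w) (hz : r z ≠ 0) : r w ≠ 0 := by
  induction h with
  | refl => exact hz
  | tail _ hbc ih =>
    rw [← hr]
    exact fun h0 => mul_ne_zero ih hbc (ENNReal.tsum_eq_zero.1 h0 _)

/-- The minimum `m` of two stationary laws is subinvariant with preserved finite mass, hence
invariant. If the laws differ, `p - m` and `q - m` are non-zero invariant measures, both positive at
`z₀`; but one of them vanishes there. -/
theorem stationary_unique {P : X → PMF X} {z₀ : X}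
    (hz₀ : ∀ z, Relation.ReflTransGen (Linked P) z z₀) {p q : PMF X}
    (hp : IsStationary P p) (hq : IsStationary P q) : p = q := by
  have hp' : ∀ w, ∑' z, p z * P z w = p w := fun w => by
    conv_rhs => rw [← hp]
    rw [PMF.bind_apply]
  have hq' : ∀ w, ∑' z, q z * P z w = q w := fun w => by
    conv_rhs => rw [← hq]
    rw [PMF.bind_apply]
  set m : X → ℝ≥0∞ := fun z => min (p z) (q z) with hm
  have hm_top : ∑' z, m z ≠ ∞ :=
    ne_top_of_le_ne_top p.tsum_coe_ne_top (ENNReal.tsum_le_tsum fun z => min_le_left _ _)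
  have hmP_le : ∀ w, ∑' z, m z * P z w ≤ m w := fun w => le_min
    ((ENNReal.tsum_le_tsum fun z => mul_le_mul_left (min_le_left _ _) _).trans (hp' w).le)
    ((ENNReal.tsum_le_tsum fun z => mul_le_mul_left (min_le_right _ _) _).trans (hq' w).le)
  have hmP_sum : ∑' w, ∑' z, m z * P z w = ∑' z, m z := by
    rw [ENNReal.tsum_comm]
    simp [ENNReal.tsum_mul_left]
  have hmP : ∀ w, ∑' z, m z * P z w = m w := fun w => by
    refine (hmP_le w).antisymm (not_lt.1 fun hlt => ?_)
    have := ENNReal.tsum_lt_tsum (hmP_sum ▸ hm_top) hmP_le hlt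
    exact this.ne hmP_sum
  have hm_ne : ∀ w, m w ≠ ∞ := fun w => ENNReal.ne_top_of_tsum_ne_top hm_top w
  have key : ∀ p : PMF X, (∀ w, m w ≤ p w) → (∀ w, ∑' z, p z * P z w = p w) →
      ∀ w, ∑' z, (p z - m z) * P z w = p w - m w := by
    intro p hle hp w
    have h1 : ∑' z, (p z - m z) * P z w + ∑' z, m z * P z w = p w := by
      rw [← ENNReal.tsum_add, ← hp w]
      congr 1 with z
      rw [← add_mul, tsub_add_cancel_of_le (hle z)]
    rw [hmP] at h1
    exact ENNReal.eq_sub_of_add_eq (hm_ne w) h1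
  by_contra hne
  have h1 : ∃ z, p z - m z ≠ 0 := by
    by_contra! h
    exact hne (PMF_eq_of_le fun z => (tsub_eq_zero_iff_le.1 (h z)).trans (min_le_right _ _))
  have h2 : ∃ z, q z - m z ≠ 0 := by
    by_contra! h
    exact hne (PMF_eq_of_le fun z => (tsub_eq_zero_iff_le.1 (h z)).trans (min_le_left _ _)).symm
  obtain ⟨z, hz⟩ := h1
  obtain ⟨w, hw⟩ := h2
  have h3 := pos_of_reachable (key p (fun _ => min_le_left _ _) hp') (hz₀ z) hz
  have h4 := pos_of_reachable (key q (fun _ => min_le_right _ _) hq') (hz₀ w) hw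
  rcases le_total (p z₀) (q z₀) with h | h
  · simp [hm, h] at h3
  · simp [hm, h] at h4

/-! ### Cesàro averages -/

theorem lawAt_succ (P : X → PMF X) (ν : PMF X) (n : ℕ) :
    lawAt P ν (n + 1) = (lawAt P ν n).bind P :=
  Function.iterate_succ_apply' _ _ _

theorem lawAt_eq_bind (P : X → PMF X) (ν : PMF X) (n : ℕ) :
    lawAt P ν n = ν.bind fun z => lawAt P (PMF.pure z) n := by
  induction n with
  | zero => simp [lawAt]
  | succ n ih => simp only [lawAt_succ]; rw [ih, PMF.bind_bind]

theorem cesaro_eq_bind (P : X → PMF X) (ν : PMF X) (n : ℕ) :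
    cesaro P ν n = ν.bind fun z => cesaro P (PMF.pure z) n := by
  simp only [cesaro]
  rw [PMF.bind_comm]
  congr 1 with k : 1
  exact lawAt_eq_bind P ν k

theorem expect_cesaro (P : X → PMF X) (ν : PMF X) (n : ℕ) (f : X → ℝ≥0∞) :
    expect (cesaro P ν n) f = ((n : ℝ≥0∞) + 1)⁻¹ * ∑ k ∈ Finset.range (n + 1),
      expect (lawAt P ν k) f := by
  rw [cesaro, expect_bind, expect, tsum_fintype, Finset.sum_range, Finset.mul_sum]
  simp

theorem cesaro_apply (P : X → PMF X) (ν : PMF X) (n : ℕ) (w : X) :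
    cesaro P ν n w = ((n : ℝ≥0∞) + 1)⁻¹ * ∑ k ∈ Finset.range (n + 1), lawAt P ν k w := by
  rw [cesaro, PMF.bind_apply, tsum_fintype, Finset.sum_range, Finset.mul_sum]
  simp

/-- One step shifts the averaging window by one, so only the last term, at most `1 / (n + 1)`, is
gained. -/
theorem cesaro_step_le (P : X → PMF X) (ν : PMF X) (n : ℕ) (w : X) :
    ∑' z, cesaro P ν n z * P z w ≤ cesaro P ν n w + ((n : ℝ≥0∞) + 1)⁻¹ := by
  have h1 : ∑' z, cesaro P ν n z * P z w =
      ((n : ℝ≥0∞) + 1)⁻¹ * ∑ k ∈ Finset.range (n + 1), lawAt P ν (k + 1) w := by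
    refine (expect_cesaro P ν n fun z => P z w).trans ?_
    simp only [lawAt_succ, PMF.bind_apply, expect]
  have h2 : ∑ k ∈ Finset.range (n + 1), lawAt P ν (k + 1) w ≤
      ∑ k ∈ Finset.range (n + 1), lawAt P ν k w + 1 := by
    calc _ ≤ ∑ k ∈ Finset.range (n + 1), lawAt P ν (k + 1) w + lawAt P ν 0 w := le_self_add
      _ = ∑ k ∈ Finset.range (n + 2), lawAt P ν k w :=
        (Finset.sum_range_succ' (fun k => lawAt P ν k w) _).symm
      _ = ∑ k ∈ Finset.range (n + 1), lawAt P ν k w + lawAt P ν (n + 1) w :=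
        Finset.sum_range_succ _ _
      _ ≤ _ := by gcongr; exact PMF.coe_le_one _ _
  rw [h1, cesaro_apply]
  calc _ ≤ ((n : ℝ≥0∞) + 1)⁻¹ * (∑ k ∈ Finset.range (n + 1), lawAt P ν k w + 1) := by gcongr
    _ = _ := by rw [mul_add, mul_one]

/-- A sequence of laws is tight. -/
def IsTightSeq (c : ℕ → PMF X) : Prop :=
  ∀ ε : ℝ≥0∞, ε ≠ 0 → ∃ K : Finset X, ∀ n, 1 ≤ ∑ z ∈ K, c n z + ε

/-- Pointwise limits along an ultrafilter exist by compactness of `[0, ∞]`. Tightness keeps their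
mass equal to 1, and finite partial sums give `ρ P ≤ ρ`, which is enough for equality. -/
theorem exists_stationary_limit {P : X → PMF X} {ν : PMF X} (ht : IsTightSeq (cesaro P ν))
    (g : Ultrafilter ℕ) (hg : (g : Filter ℕ) ≤ atTop) :
    ∃ ρ : PMF X, IsStationary P ρ ∧ ∀ z, Tendsto (fun n => cesaro P ν n z) g (𝓝 (ρ z)) := by
  have hlim : ∀ z, ∃ a, Tendsto (fun n => cesaro P ν n z) g (𝓝 a) := fun z => by
    obtain ⟨a, -, ha⟩ := isCompact_univ.ultrafilter_le_nhds
      (g.map fun n => cesaro P ν n z) (by simp)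
    exact ⟨a, ha⟩
  choose r hr using hlim
  have hK : ∀ K : Finset X, Tendsto (fun n => ∑ z ∈ K, cesaro P ν n z) g (𝓝 (∑ z ∈ K, r z)) :=
    fun K => tendsto_finsetSum K fun z _ => hr z
  have hle : ∑' z, r z ≤ 1 := by
    rw [ENNReal.tsum_eq_iSup_sum]
    exact iSup_le fun K => le_of_tendsto' (hK K) fun n =>
      (ENNReal.sum_le_tsum K).trans (PMF.tsum_coe _).le
  have hge : 1 ≤ ∑' z, r z := by
    refine ENNReal.le_of_forall_pos_le_add fun ε hε _ => ?_
    obtain ⟨K, h⟩ := ht ε (by exact_mod_cast hε.ne')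
    calc (1 : ℝ≥0∞) ≤ ∑ z ∈ K, r z + ε :=
        ge_of_tendsto' ((hK K).add tendsto_const_nhds) h
      _ ≤ _ := by gcongr; exact ENNReal.sum_le_tsum K
  have hsum := hle.antisymm hge
  have hP_le : ∀ w, ∑' z, r z * P z w ≤ r w := fun w => by
    rw [ENNReal.tsum_eq_iSup_sum]
    refine iSup_le fun K => ?_
    have h1 : Tendsto (fun n => ∑ z ∈ K, cesaro P ν n z * P z w) g (𝓝 (∑ z ∈ K, r z * P z w)) :=
      tendsto_finsetSum K fun z _ => ENNReal.Tendsto.mul_const (hr z) (Or.inr (PMF.apply_ne_top _ _))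
    have h2 : Tendsto (fun n : ℕ => cesaro P ν n w + ((n : ℝ≥0∞) + 1)⁻¹) g (𝓝 (r w + 0)) := by
      refine (hr w).add (Tendsto.mono_left ?_ hg)
      have := (tendsto_add_atTop_iff_nat 1).2 ENNReal.tendsto_inv_nat_nhds_zero
      simpa using this
    rw [add_zero] at h2
    exact le_of_tendsto_of_tendsto' h1 h2 fun n =>
      (ENNReal.sum_le_tsum K).trans (cesaro_step_le P ν n w)
  let ρ : PMF X := ⟨r, hsum ▸ ENNReal.summable.hasSum⟩
  refine ⟨ρ, PMF_eq_of_le fun w => ?_, hr⟩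
  rw [PMF.bind_apply]
  exact hP_le w

theorem tendsto_toProbabilityMeasure [TopologicalSpace X] [MeasurableSpace X]
    [OpensMeasurableSpace X] [MeasurableSingletonClass X] {c : ℕ → PMF X} {p : PMF X}
    (h : ∀ z, Tendsto (fun n => c n z) atTop (𝓝 (p z))) :
    Tendsto (fun n => toProbabilityMeasure (c n)) atTop (𝓝 (toProbabilityMeasure p)) := by
  -- Portmanteau: only the lower bound on open sets is needed, and it follows from finite partial
  -- sums.
  refine tendsto_of_forall_isOpen_le_liminf' fun G _ => ?_
  change p.toMeasure G ≤ liminf (fun n => (c n).toMeasure G) atTop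
  rw [PMF.toMeasure_apply_eq_tsum, ENNReal.tsum_eq_iSup_sum]
  refine iSup_le fun K => ?_
  have hK : Tendsto (fun n => ∑ z ∈ K, G.indicator (c n) z) atTop
      (𝓝 (∑ z ∈ K, G.indicator p z)) := by
    refine tendsto_finsetSum K fun z _ => ?_
    by_cases hz : z ∈ G
    · simpa [hz] using h z
    · simp [hz]
  rw [← hK.liminf_eq]
  refine liminf_le_liminf (Eventually.of_forall fun n => ?_)
  rw [PMF.toMeasure_apply_eq_tsum]
  exact ENNReal.sum_le_tsum K

theorem tendsto_cesaro_of_pure {P : X → PMF X} {p : PMF X}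
    (h : ∀ z w, Tendsto (fun n => cesaro P (PMF.pure z) n w) atTop (𝓝 (p w)))
    (ν : PMF X) (w : X) : Tendsto (fun n => cesaro P ν n w) atTop (𝓝 (p w)) := by
  have h1 : ∀ n, cesaro P ν n w ≠ ∞ := fun n => PMF.apply_ne_top _ _
  refine (ENNReal.tendsto_toReal_iff h1 (PMF.apply_ne_top _ _)).1 ?_
  have hs : Summable fun z => (ν z).toReal := ENNReal.summable_toReal ν.tsum_coe_ne_top
  have h2 : ∀ n, (cesaro P ν n w).toReal =
      ∑' z, (ν z).toReal * (cesaro P (PMF.pure z) n w).toReal := fun n => by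
    rw [cesaro_eq_bind, PMF.bind_apply, ENNReal.tsum_toReal_eq fun z =>
      ENNReal.mul_ne_top (PMF.apply_ne_top _ _) (PMF.apply_ne_top _ _)]
    simp
  have h3 : (p w).toReal = ∑' z, (ν z).toReal * (p w).toReal := by
    rw [tsum_mul_right, ← ENNReal.tsum_toReal_eq fun z => PMF.apply_ne_top _ _, ν.tsum_coe]
    simp
  simp only [h2]
  rw [h3]
  refine tendsto_tsum_of_dominated_convergence (bound := fun z => (ν z).toReal) hs ?_ ?_
  · exact fun z => Tendsto.const_mul _
      ((ENNReal.tendsto_toReal (PMF.apply_ne_top _ _)).comp (h z w))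
  · refine Eventually.of_forall fun n z => ?_
    rw [Real.norm_of_nonneg (by positivity)]
    refine mul_le_of_le_one_right ENNReal.toReal_nonneg ?_
    exact ENNReal.toReal_le_of_le_ofReal one_pos.le (by simpa using PMF.coe_le_one _ _)

/-- A chain with tight Cesàro averages, in which some state can be reached from all states, is
stable. -/
theorem isStable_of_tight [TopologicalSpace X] [MeasurableSpace X] [OpensMeasurableSpace X]
    [MeasurableSingletonClass X]
    {P : X → PMF X} {z₀ : X} (hz₀ : ∀ z, Relation.ReflTransGen (Linked P) z z₀)
    (ht : ∀ z, IsTightSeq (cesaro P (PMF.pure z))) : IsStable P := by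
  obtain ⟨g, hg⟩ := Filter.exists_ultrafilter_le (atTop : Filter ℕ)
  obtain ⟨p, hp, -⟩ := exists_stationary_limit (ht z₀) g hg
  refine ⟨p, hp, fun q hq => stationary_unique hz₀ hq hp, fun ν => ?_⟩
  refine tendsto_toProbabilityMeasure (tendsto_cesaro_of_pure (fun z w => ?_) ν)
  -- All ultrafilter limits are stationary laws, hence equal to `p`; so the whole sequence
  -- converges.
  rw [tendsto_iff_ultrafilter]
  intro g hg
  obtain ⟨q, hq, hlim⟩ := exists_stationary_limit (ht z) g hg
  rw [stationary_unique hz₀ hp hq]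
  exact hlim w

/-! ### The drift criterion -/

/-- The drift inequality telescopes along the trajectory. It is written additively because `L` takes
values in `ℝ≥0∞`. -/
theorem expect_cesaro_le_of_drift {P : X → PMF X} {L V : X → ℝ≥0∞} {B : ℝ≥0∞}
    (hd : ∀ z, expect (P z) L + V z ≤ L z + B) (z : X) (n : ℕ) :
    expect (cesaro P (PMF.pure z) n) V ≤ L z + B := by
  set l : ℕ → ℝ≥0∞ := fun k => expect (lawAt P (PMF.pure z) k) L with hl
  set v : ℕ → ℝ≥0∞ := fun k => expect (lawAt P (PMF.pure z) k) V with hv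
  have hstep : ∀ k, l (k + 1) + v k ≤ l k + B := fun k => by
    simp only [hl, hv, lawAt_succ, expect_bind]
    rw [← expect_add, ← expect_const (lawAt P (PMF.pure z) k) B, ← expect_add]
    exact expect_mono fun z _ => by simpa [expect_const] using hd z
  have hsum : ∀ n : ℕ, l n + ∑ k ∈ Finset.range n, v k ≤ L z + n * B := by
    intro n
    induction n with
    | zero => simp [hl, lawAt, expect_pure]
    | succ n ih =>
      calc l (n + 1) + ∑ k ∈ Finset.range (n + 1), v k
          = (l (n + 1) + v n) + ∑ k ∈ Finset.range n, v k := by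
            rw [Finset.sum_range_succ]; ring
        _ ≤ (l n + B) + ∑ k ∈ Finset.range n, v k := add_le_add_left (hstep n) _
        _ = (l n + ∑ k ∈ Finset.range n, v k) + B := by ring
        _ ≤ (L z + n * B) + B := by gcongr
        _ = _ := by push_cast; ring
  rw [expect_cesaro]
  have hn : ((n : ℝ≥0∞) + 1) ≠ 0 := by simp
  have hn' : ((n : ℝ≥0∞) + 1) ≠ ∞ := by finiteness
  have h1 : (1 : ℝ≥0∞) ≤ n + 1 := le_add_self
  calc ((n : ℝ≥0∞) + 1)⁻¹ * ∑ k ∈ Finset.range (n + 1), v k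
      ≤ ((n : ℝ≥0∞) + 1)⁻¹ * ((n + 1) * (L z + B)) := by
        gcongr
        refine (le_add_self.trans (hsum (n + 1))).trans ?_
        rw [mul_add]
        push_cast
        gcongr
        exact le_mul_of_one_le_left' h1
    _ = L z + B := by rw [← mul_assoc, ENNReal.inv_mul_cancel hn hn', one_mul]

/-- Markov's inequality for `V` outside `K`. -/
theorem one_le_sum_add_of_expect_le {p : PMF X} {V : X → ℕ} {A ε : ℝ≥0∞} {N : ℕ} {K : Finset X}
    (hp : expect p (fun z => V z) ≤ A) (hN : A < N * ε) (hK : ∀ z, z ∉ K → N ≤ V z) :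
    1 ≤ ∑ z ∈ K, p z + ε := by
  have h2 : ∑ w ∈ K, p w + ∑' w : ((K : Set X)ᶜ : Set X), p w = 1 := by
    rw [← p.tsum_coe, ← Finset.tsum_subtype' K p]
    exact ENNReal.summable.tsum_add_tsum_compl ENNReal.summable
  rw [← h2]
  refine add_le_add_right ?_ _
  have h3 : (N : ℝ≥0∞) * ∑' w : ((K : Set X)ᶜ : Set X), p w ≤ A := by
    refine le_trans ?_ hp
    rw [← ENNReal.tsum_mul_left]
    refine le_trans (ENNReal.tsum_le_tsum fun w => ?_)
      (ENNReal.tsum_comp_le_tsum_of_injective Subtype.val_injective fun w => p w * V w)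
    rw [mul_comm]
    gcongr
    exact_mod_cast hK w w.2
  by_contra! hlt
  exact absurd (h3.trans_lt hN) (not_lt.2 (mul_le_mul_right hlt.le _))

theorem isTightSeq_of_drift {P : X → PMF X} {L : X → ℝ≥0∞} {V : X → ℕ} {δ B : ℝ≥0∞}
    (hd : ∀ z, expect (P z) L + δ * V z ≤ L z + B) (hδ : δ ≠ 0) (hδ' : δ ≠ ∞)
    (hL : ∀ z, L z ≠ ∞) (hB : B ≠ ∞) (hV : ∀ N, {z | V z < N}.Finite) (z : X) :
    IsTightSeq (cesaro P (PMF.pure z)) := by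
  intro ε hε
  have hA : L z + B ≠ ∞ := ENNReal.add_ne_top.2 ⟨hL z, hB⟩
  obtain ⟨N, hN⟩ := ENNReal.exists_nat_mul_gt (mul_ne_zero hδ hε) hA
  refine ⟨(hV N).toFinset, fun n => ?_⟩
  have h1 := expect_cesaro_le_of_drift hd z n
  rw [expect_const_mul] at h1
  refine one_le_sum_add_of_expect_le (V := V) (A := δ⁻¹ * (L z + B)) (N := N) ?_ ?_ (by simp)
  · rwa [mul_comm, ← div_eq_mul_inv, ENNReal.le_div_iff_mul_le (by simp [hδ]) (by simp [hδ']),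
        mul_comm]
  · rw [mul_comm, ← div_eq_mul_inv, ENNReal.div_lt_iff (by simp [hδ]) (by simp [hδ'])]
    convert hN using 1
    ring

end Chain

section Drift

variable {X : Type*}

/-! ### Functions of a stationary chain -/

/-- The mean increment of `f` over one step from `z`. -/
noncomputable def drift (P : X → PMF X) (f : X → ℝ) (z : X) : ℝ :=
  ∑' w, (P z w).toReal * (f w - f z)

theorem summable_toReal (p : PMF X) : Summable fun z => (p z).toReal :=
  ENNReal.summable_toReal p.tsum_coe_ne_top

theorem tsum_toReal (p : PMF X) : ∑' z, (p z).toReal = 1 := by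
  rw [← ENNReal.tsum_toReal_eq fun z => PMF.apply_ne_top _ _, p.tsum_coe, ENNReal.toReal_one]

theorem norm_toReal_mul_le {p : PMF X} {f : X → ℝ} {M : ℝ} (h : ∀ z, p z ≠ 0 → |f z| ≤ M) (z : X) :
    ‖(p z).toReal * f z‖ ≤ (p z).toReal * M := by
  rw [norm_mul, Real.norm_of_nonneg ENNReal.toReal_nonneg, Real.norm_eq_abs]
  by_cases hz : p z = 0
  · simp [hz]
  · exact mul_le_mul_of_nonneg_left (h z hz) ENNReal.toReal_nonneg

theorem summable_toReal_mul {p : PMF X} {f : X → ℝ} {M : ℝ} (h : ∀ z, p z ≠ 0 → |f z| ≤ M) :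
    Summable fun z => (p z).toReal * f z :=
  .of_norm_bounded ((summable_toReal p).mul_right M) (norm_toReal_mul_le h)

theorem norm_tsum_toReal_mul_le {p : PMF X} {f : X → ℝ} {M : ℝ} (h : ∀ z, p z ≠ 0 → |f z| ≤ M) :
    ‖∑' z, (p z).toReal * f z‖ ≤ M := by
  refine tsum_of_norm_bounded ?_ (norm_toReal_mul_le h)
  have := (summable_toReal p).hasSum.mul_right M
  rwa [tsum_toReal, one_mul] at this

theorem tsum_drift_eq_zero_of_bounded {P : X → PMF X} {p : PMF X} (hp : IsStationary P p)
    {g : X → ℝ} {M : ℝ} (hg : ∀ z, |g z| ≤ M) : ∑' z, (p z).toReal * drift P g z = 0 := by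
  have hs : Summable fun zw : X × X => (p zw.1).toReal * (P zw.1 zw.2).toReal := by
    have hnn : ∀ zw : X × X, 0 ≤ (p zw.1).toReal * (P zw.1 zw.2).toReal :=
      fun _ => mul_nonneg ENNReal.toReal_nonneg ENNReal.toReal_nonneg
    refine (summable_prod_of_nonneg
      (f := fun zw : X × X => (p zw.1).toReal * (P zw.1 zw.2).toReal) hnn).2 ⟨fun z => ?_, ?_⟩
    · exact (summable_toReal (P z)).mul_left (p z).toReal
    · simp only [tsum_mul_left, tsum_toReal, mul_one]
      exact summable_toReal p
  have hs' : Summable fun zw : X × X => (p zw.1).toReal * (P zw.1 zw.2).toReal * g zw.2 := by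
    refine .of_norm_bounded (hs.mul_right M) fun zw => ?_
    rw [norm_mul, Real.norm_of_nonneg (by positivity)]
    exact mul_le_mul_of_nonneg_left (hg _) (by positivity)
  have hp' : ∀ w, ∑' z, (p z).toReal * (P z w).toReal = (p w).toReal := fun w => by
    conv_rhs => rw [← hp, PMF.bind_apply]
    rw [ENNReal.tsum_toReal_eq fun z =>
      ENNReal.mul_ne_top (PMF.apply_ne_top _ _) (PMF.apply_ne_top _ _)]
    simp
  have h1 : ∑' z, (p z).toReal * ∑' w, (P z w).toReal * g w = ∑' w, (p w).toReal * g w := by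
    have h2 := hs'.tsum_comm (f := fun z w => (p z).toReal * (P z w).toReal * g w)
    simp only [mul_assoc, tsum_mul_left] at h2
    rw [← h2]
    congr 1 with w
    simp only [← mul_assoc, tsum_mul_right, hp']
  have hd : ∀ z, drift P g z = ∑' w, (P z w).toReal * g w - g z := fun z => by
    simp only [drift, mul_sub]
    rw [Summable.tsum_sub (summable_toReal_mul fun w _ => hg w) ((summable_toReal _).mul_right _),
      tsum_mul_right, tsum_toReal, one_mul]
  simp only [hd, mul_sub]
  rw [Summable.tsum_sub, h1, sub_self]
  · exact summable_toReal_mul fun z _ => norm_tsum_toReal_mul_le fun w _ => hg w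
  · exact summable_toReal_mul fun z _ => hg z

theorem tsum_drift_eq_zero {P : X → PMF X} {p : PMF X} (hp : IsStationary P p)
    {f : X → ℝ} {M : ℝ} (hf : ∀ z w, P z w ≠ 0 → |f w - f z| ≤ M) :
    ∑' z, (p z).toReal * drift P f z = 0 := by
  -- `f` need not be integrable under `p`. Truncation to `[-N, N]` is 1-Lipschitz, so the drifts
  -- stay bounded by `M` and dominated convergence applies.
  set g : ℕ → X → ℝ := fun N z => max (-N) (min N (f z)) with hg
  have hgM : ∀ N z, |g N z| ≤ N := fun N z => by
    rw [abs_le]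
    exact ⟨le_max_left _ _, max_le (by linarith [(Nat.cast_nonneg N : (0 : ℝ) ≤ N)])
      (min_le_left _ _)⟩
  have hgf : ∀ N z w, |g N w - g N z| ≤ |f w - f z| := fun N z w =>
    (abs_max_sub_max_le_max _ _ _ _).trans (max_le (by simp)
      ((abs_min_sub_min_le_max _ _ _ _).trans (by simp)))
  have hlim : Tendsto (fun N => ∑' z, (p z).toReal * drift P (g N) z) atTop
      (𝓝 (∑' z, (p z).toReal * drift P f z)) := by
    refine tendsto_tsum_of_dominated_convergence ((summable_toReal p).mul_right M) (fun z => ?_)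
      (Eventually.of_forall fun N => norm_toReal_mul_le fun z _ =>
        norm_tsum_toReal_mul_le fun w hw => (hgf N z w).trans (hf z w hw))
    refine tendsto_const_nhds.congr' ?_
    -- From this `N` on, the truncation changes neither `f z` nor the values after one step.
    filter_upwards [eventually_ge_atTop ⌈|f z| + |M|⌉₊] with N hN
    have hN' : |f z| + |M| ≤ N := (Nat.le_ceil _).trans (by exact_mod_cast hN)
    have hgz : ∀ w, |f w| ≤ N → g N w = f w := fun w hw => by
      rw [abs_le] at hw
      simp only [hg]
      rw [min_eq_right hw.2, max_eq_right hw.1]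
    congr 1
    simp only [drift]
    congr 1 with w
    by_cases hw : P z w = 0
    · simp [hw]
    · rw [hgz z (by linarith [abs_nonneg M]), hgz w]
      have h1 := hf z w hw
      have h2 : |f w| ≤ |f w - f z| + |f z| := by
        simpa using abs_add_le (f w - f z) (f z)
      linarith [le_abs_self M]
  simp only [tsum_drift_eq_zero_of_bounded hp (hgM _)] at hlim
  exact tendsto_nhds_unique hlim tendsto_const_nhds

theorem drift_eq_zero {P : X → PMF X} {p : PMF X} (hp : IsStationary P p)
    {f : X → ℝ} {M : ℝ} (hf : ∀ z w, P z w ≠ 0 → |f w - f z| ≤ M)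
    (h0 : ∀ z, 0 ≤ drift P f z) {z : X} (hz : p z ≠ 0) : drift P f z = 0 := by
  have hs : Summable fun z => (p z).toReal * drift P f z :=
    summable_toReal_mul fun z _ => norm_tsum_toReal_mul_le fun w hw => hf z w hw
  have h1 := (hs.hasSum_iff.2 (tsum_drift_eq_zero hp hf))
  rw [hasSum_zero_iff_of_nonneg fun z => mul_nonneg ENNReal.toReal_nonneg (h0 z)] at h1
  have h2 := congrFun h1 z
  exact (mul_eq_zero.1 h2).resolve_left
    (ENNReal.toReal_ne_zero.2 ⟨hz, PMF.apply_ne_top _ _⟩)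

theorem eq_zero_of_tsum_toReal_mul_eq_zero {p : PMF X} {f : X → ℝ} {M : ℝ}
    (hM : ∀ z, p z ≠ 0 → |f z| ≤ M) (h0 : ∀ z, p z ≠ 0 → 0 ≤ f z)
    (h : ∑' z, (p z).toReal * f z = 0) {z : X} (hz : p z ≠ 0) : f z = 0 := by
  have h1 := (summable_toReal_mul hM).hasSum_iff.2 h
  rw [hasSum_zero_iff_of_nonneg] at h1
  · exact (mul_eq_zero.1 (congrFun h1 z)).resolve_left
      (ENNReal.toReal_ne_zero.2 ⟨hz, PMF.apply_ne_top _ _⟩)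
  · intro w
    by_cases hw : p w = 0
    · simp [hw]
    · exact mul_nonneg ENNReal.toReal_nonneg (h0 w hw)

/-- A submartingale with bounded increments which is a function of a stationary chain is
constant along the trajectories. -/
theorem eq_of_stationary_submartingale {P : X → PMF X} {p : PMF X} (hp : IsStationary P p)
    {f : X → ℝ} {M : ℝ} (hf : ∀ z w, P z w ≠ 0 → |f w - f z| ≤ M)
    (h0 : ∀ z, 0 ≤ drift P f z) {z w : X} (hz : p z ≠ 0) (hw : P z w ≠ 0) : f w = f z := by
  -- Truncating below at the current level `k` keeps the submartingale property. From `z` the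
  -- increments of `max f k` are non-negative with mean zero, so `f` cannot rise; its own drift at
  -- `z` is also zero, so it cannot fall.
  set k := f z with hk
  have hgf : ∀ z w, |max (f w) k - max (f z) k| ≤ |f w - f z| := fun z w =>
    (abs_max_sub_max_le_max _ _ _ _).trans (by simp)
  have hgM : ∀ z w, P z w ≠ 0 → |max (f w) k - max (f z) k| ≤ M :=
    fun z w h => (hgf z w).trans (hf z w h)
  have hg0 : ∀ z, 0 ≤ drift P (fun z => max (f z) k) z := fun z => by
    rcases le_total k (f z) with h | h
    · refine (h0 z).trans (Summable.tsum_le_tsum (fun w => ?_) (summable_toReal_mul (hf z))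
        (summable_toReal_mul (hgM z)))
      refine mul_le_mul_of_nonneg_left ?_ ENNReal.toReal_nonneg
      simp only [max_eq_left h]
      linarith [le_max_left (f w) k]
    · refine tsum_nonneg fun w => mul_nonneg ENNReal.toReal_nonneg ?_
      simp only [max_eq_right h]
      linarith [le_max_right (f w) k]
  have hup : ∀ w, P z w ≠ 0 → f w ≤ f z := fun w hw => by
    have h1 := eq_zero_of_tsum_toReal_mul_eq_zero (hgM z)
      (fun w _ => by rw [← hk, max_self]; linarith [le_max_right (f w) k])
      (drift_eq_zero hp hgM hg0 hz) hw
    rw [← hk, max_self] at h1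
    linarith [le_max_left (f w) k]
  have h2 := drift_eq_zero hp hf h0 hz
  have h3 : ∑' w, (P z w).toReal * (f z - f w) = 0 := by
    rw [← neg_eq_zero, ← h2, drift, ← tsum_neg]
    congr 1 with w
    ring
  have h4 := eq_zero_of_tsum_toReal_mul_eq_zero (fun w hw => by rw [abs_sub_comm]; exact hf z w hw)
    (fun w hw => sub_nonneg.2 (hup w hw)) h3 hw
  linarith

theorem drift_bind_nonneg {A : Type*} [Fintype A] {P : X → PMF X} {μ : PMF A}
    {q : A → PMF X} {z : X} (hP : P z = μ.bind q) {f : X → ℝ} {M : ℝ} {b : A → ℝ}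
    (hf : ∀ a, ∀ w, q a w ≠ 0 → |f w - f z| ≤ M) (hb : ∀ a, ∀ w, q a w ≠ 0 → b a ≤ f w - f z)
    (h0 : 0 ≤ ∑ a, (μ a).toReal * b a) : 0 ≤ drift P f z := by
  have h1 : drift P f z = ∑ a, (μ a).toReal * ∑' w, (q a w).toReal * (f w - f z) := by
    simp only [← tsum_mul_left]
    rw [← Summable.tsum_finsetSum fun a _ => (summable_toReal_mul (hf a)).mul_left _]
    refine tsum_congr fun w => ?_
    rw [hP, PMF.bind_apply, tsum_fintype, ENNReal.toReal_sum fun a _ =>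
      ENNReal.mul_ne_top (PMF.apply_ne_top _ _) (PMF.apply_ne_top _ _), Finset.sum_mul]
    simp [mul_assoc]
  rw [h1]
  refine h0.trans (Finset.sum_le_sum fun a _ =>
    mul_le_mul_of_nonneg_left ?_ ENNReal.toReal_nonneg)
  have hs : Summable fun w => (q a w).toReal * b a := (summable_toReal _).mul_right _
  have h2 : b a = ∑' w, (q a w).toReal * b a := by rw [tsum_mul_right, tsum_toReal, one_mul]
  rw [h2]
  refine hs.tsum_le_tsum (fun w => ?_) (summable_toReal_mul (hf a))
  by_cases hw : q a w = 0
  · simp [hw]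
  · exact mul_le_mul_of_nonneg_left (hb a w hw) ENNReal.toReal_nonneg

theorem lawAt_support_of_monotone {P : X → PMF X} {f : X → ℝ}
    (hf : ∀ z w, P z w ≠ 0 → f z ≤ f w) (z : X) (n : ℕ) {w : X}
    (hw : lawAt P (PMF.pure z) n w ≠ 0) : f z ≤ f w := by
  induction n generalizing w with
  | zero =>
    have : w = z := by simpa [lawAt] using hw
    rw [this]
  | succ n ih =>
    rw [lawAt_succ, ← PMF.mem_support_iff, PMF.mem_support_bind_iff] at hw
    obtain ⟨v, hv, hvw⟩ := hw
    exact (ih hv).trans (hf v w hvw)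

/-- From a start with `f` above its value at an atom `v` of `p`, the chain never visits `v`; the
open set `{v}` then contradicts weak convergence. -/
theorem not_isAttractive_of_monotone [TopologicalSpace X] [MeasurableSpace X]
    [OpensMeasurableSpace X] [DiscreteTopology X] {P : X → PMF X}
    {f : X → ℝ} (hf : ∀ z w, P z w ≠ 0 → f z ≤ f w) (hunb : ∀ k : ℕ, ∃ z, (k : ℝ) ≤ f z)
    (p : PMF X) : ¬ IsAttractive P p := by
  intro hatt
  obtain ⟨v, hv⟩ := p.support_nonempty
  obtain ⟨k, hk⟩ := exists_nat_gt (f v)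
  obtain ⟨z, hz⟩ := hunb k
  have h1 := ProbabilityMeasure.le_liminf_measure_open_of_tendsto (hatt (PMF.pure z))
    (isOpen_discrete {v})
  have h2 : ∀ n, (toProbabilityMeasure (cesaro P (PMF.pure z) n) : Measure X) {v} = 0 := by
    intro n
    change (cesaro P (PMF.pure z) n).toMeasure {v} = 0
    rw [PMF.toMeasure_apply_singleton _ _ (isOpen_discrete _).measurableSet, cesaro_apply]
    simp only [mul_eq_zero, Finset.sum_eq_zero_iff]
    refine Or.inr fun i _ => ?_
    by_contra h
    linarith [lawAt_support_of_monotone hf z i h]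
  simp only [h2, liminf_const] at h1
  change p.toMeasure {v} ≤ 0 at h1
  rw [PMF.toMeasure_apply_singleton _ _ (isOpen_discrete _).measurableSet] at h1
  exact hv (le_zero_iff.1 h1)

end Drift

/-! ### Adding and removing an individual -/

section Counting

variable {A : Type*} [Fintype A]

theorem addOne_self {A : Type*} (x : A → ℕ) (a : A) : addOne x a a = x a + 1 := by
  simp [addOne]

theorem sum_mul_addOne (u : A → ℝ) (x : A → ℕ) (a : A) :
    ∑ i, u i * addOne x a i = ∑ i, u i * x i + u a := by
  classical
  simp [addOne, mul_add, Finset.sum_add_distrib, Pi.single_apply]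

theorem sum_mul_removeOne (u : A → ℝ) (x : A → ℕ) (a : A) (h : 0 < x a) :
    ∑ i, u i * removeOne x a i = ∑ i, u i * x i - u a := by
  have := sum_mul_addOne u (removeOne x a) a
  rw [addOne_removeOne x a h] at this
  linarith

theorem sum_sq_addOne (x : A → ℕ) (a : A) :
    ∑ i, addOne x a i ^ 2 = ∑ i, x i ^ 2 + 2 * x a + 1 := by
  classical
  have h : ∀ i, addOne x a i ^ 2 = x i ^ 2 + if i = a then 2 * x a + 1 else 0 := fun i => by
    by_cases hi : i = a
    · subst hi
      simp [addOne_self]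
      ring
    · simp [addOne_of_ne x hi, hi]
  simp [h, Finset.sum_add_distrib]
  ring

theorem sum_sq_removeOne (x : A → ℕ) (a : A) (h : 0 < x a) :
    ∑ i, removeOne x a i ^ 2 + 2 * x a = ∑ i, x i ^ 2 + 1 := by
  have h1 := sum_sq_addOne (removeOne x a) a
  have h2 := addOne_self (removeOne x a) a
  rw [addOne_removeOne x a h] at h1 h2
  omega

/-- Only an inequality, since `a = b` is possible and the removal then shortens the queue that is
joined. -/
theorem sum_sq_addOne_removeOne_le (x : A → ℕ) (a b : A) (h : 0 < x a) :
    ∑ i, addOne (removeOne x a) b i ^ 2 + 2 * x a ≤ ∑ i, x i ^ 2 + 2 * x b + 2 := by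
  have h1 := sum_sq_addOne (removeOne x a) b
  have h2 := sum_sq_removeOne x a h
  have h3 := removeOne_le x a b
  omega

end Counting

/-! ### Transitions and weighted imbalances -/

section Steps

variable {C S : Type*} [Fintype C] [Fintype S] {E : Set (C × S)}

/-- The five kinds of transitions. -/
theorem Policy.step_cases (pol : Policy E) {z w : State E} {a : C × S} (hw : pol.step z a w ≠ 0) :
    (∃ hs hc i j, pol.Φ z.1.1 a.2 hs i ≠ 0 ∧ pol.Ψ z.1.2 a.1 hc j ≠ 0 ∧ w = z.removeBoth i j) ∨
    (∃ hs hc i, pol.Φ z.1.1 a.2 hs i ≠ 0 ∧ w = z.replaceCustomer i a.1 hc) ∨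
    (∃ hc hs j, pol.Ψ z.1.2 a.1 hc j ≠ 0 ∧ w = z.replaceServer j a.2 hs) ∨
    (¬ Nonempty (AvailableCustomers E z.1.1 a.2) ∧ ¬ Nonempty (AvailableServers E z.1.2 a.1) ∧
      a ∈ E ∧ w = z) ∨
    ∃ hE hs hc, w = z.add a.1 a.2 hE hs hc := by
  rw [← PMF.mem_support_iff, Policy.step] at hw
  split_ifs at hw with hs hc hc hE
  · simp only [PMF.mem_support_bind_iff, PMF.mem_support_map_iff] at hw
    obtain ⟨i, hi, j, hj, rfl⟩ := hw
    exact Or.inl ⟨hs, hc, i, j, hi, hj, rfl⟩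
  · rw [PMF.mem_support_map_iff] at hw
    obtain ⟨i, hi, rfl⟩ := hw
    exact Or.inr (Or.inl ⟨hs, hc, i, hi, rfl⟩)
  · rw [PMF.mem_support_map_iff] at hw
    obtain ⟨j, hj, rfl⟩ := hw
    exact Or.inr (Or.inr (Or.inl ⟨hc, hs, j, hj, rfl⟩))
  · rw [PMF.mem_support_pure_iff] at hw
    exact Or.inr (Or.inr (Or.inr (Or.inl ⟨hs, hc, hE, hw⟩)))
  · rw [PMF.mem_support_pure_iff] at hw
    exact Or.inr (Or.inr (Or.inr (Or.inr ⟨hE, hs, hc, hw⟩)))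

/-- The imbalance between the customers with weights `u` and the servers with weights `v`. -/
def imbalance (u : C → ℝ) (v : S → ℝ) (z : State E) : ℝ :=
  ∑ c, u c * z.1.1 c - ∑ s, v s * z.1.2 s

theorem Policy.le_imbalance_step (pol : Policy E) {u : C → ℝ} {v : S → ℝ}
    (huv : ∀ c s, (c, s) ∈ E → u c ≤ v s) {z w : State E} {a : C × S} (hw : pol.step z a w ≠ 0) :
    u a.1 - v a.2 ≤ imbalance u v w - imbalance u v z := by
  rcases pol.step_cases hw with ⟨hs, hc, i, j, -, -, rfl⟩ | ⟨hs, hc, i, -, rfl⟩ |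
    ⟨hc, hs, j, -, rfl⟩ | ⟨-, -, ha, rfl⟩ | ⟨hE, hs, hc, rfl⟩
  · have h1 := huv _ _ i.2.1
    have h2 := huv _ _ j.2.1
    simp only [imbalance, State.removeBoth, sum_mul_removeOne u z.1.1 i i.2.2,
      sum_mul_removeOne v z.1.2 j j.2.2]
    linarith
  · have h1 := huv _ _ i.2.1
    simp only [imbalance, State.replaceCustomer, sum_mul_addOne,
      sum_mul_removeOne u z.1.1 i i.2.2]
    linarith
  · have h2 := huv _ _ j.2.1
    simp only [imbalance, State.replaceServer, sum_mul_addOne,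
      sum_mul_removeOne v z.1.2 j j.2.2]
    linarith
  · linarith [huv _ _ ha]
  · simp only [imbalance, State.add, sum_mul_addOne]
    linarith

theorem Policy.abs_imbalance_step_le (pol : Policy E) {u : C → ℝ} {v : S → ℝ} {M : ℝ}
    (hu : ∀ c, |u c| ≤ M) (hv : ∀ s, |v s| ≤ M) {z w : State E} {a : C × S}
    (hw : pol.step z a w ≠ 0) : |imbalance u v w - imbalance u v z| ≤ 2 * M := by
  have hu' := fun c => abs_le.1 (hu c)
  have hv' := fun s => abs_le.1 (hv s)
  rw [abs_le]
  rcases pol.step_cases hw with ⟨hs, hc, i, j, -, -, rfl⟩ | ⟨hs, hc, i, -, rfl⟩ |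
    ⟨hc, hs, j, -, rfl⟩ | ⟨-, -, ha, rfl⟩ | ⟨hE, hs, hc, rfl⟩
  · simp only [imbalance, State.removeBoth, sum_mul_removeOne u z.1.1 i i.2.2,
      sum_mul_removeOne v z.1.2 j j.2.2]
    constructor <;> linarith [hu' i, hv' j]
  · simp only [imbalance, State.replaceCustomer, sum_mul_addOne,
      sum_mul_removeOne u z.1.1 i i.2.2]
    constructor <;> linarith [hu' i, hu' a.1]
  · simp only [imbalance, State.replaceServer, sum_mul_addOne,
      sum_mul_removeOne v z.1.2 j j.2.2]
    constructor <;> linarith [hv' j, hv' a.2]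
  · constructor <;> linarith [hu' a.1]
  · simp only [imbalance, State.add, sum_mul_addOne]
    constructor <;> linarith [hu' a.1, hv' a.2]

theorem Policy.chain_ne_zero (pol : Policy E) {μ : PMF (C × S)} {z w : State E} :
    pol.chain μ z w ≠ 0 ↔ ∃ a, μ a ≠ 0 ∧ pol.step z a w ≠ 0 := by
  rw [← PMF.mem_support_iff, Policy.chain, PMF.mem_support_bind_iff]
  rfl

/-! ### Stability forces NCond -/

/-- In a stable model, if every match can only increase an imbalance that is unbounded above, then
the arrivals decrease this imbalance on average. -/
theorem Policy.mean_weight_neg_of_isStable (pol : Policy E) {μ : PMF (C × S)}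
    (hst : IsStable (pol.chain μ)) {u : C → ℝ} {v : S → ℝ}
    (huv : ∀ c s, (c, s) ∈ E → u c ≤ v s)
    (hunb : ∀ k : ℕ, ∃ z : State E, (k : ℝ) ≤ imbalance u v z) :
    ∑ a, (μ a).toReal * (u a.1 - v a.2) < 0 := by
  obtain ⟨p, hp, -, hatt⟩ := hst
  by_contra! h0
  obtain ⟨M, hM⟩ : ∃ M : ℝ, (∀ c, |u c| ≤ M) ∧ ∀ s, |v s| ≤ M := by
    refine ⟨∑ c, |u c| + ∑ s, |v s|, fun c => ?_, fun s => ?_⟩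
    · exact (Finset.single_le_sum (f := fun c => |u c|) (fun _ _ => abs_nonneg _)
        (Finset.mem_univ c)).trans (le_add_of_nonneg_right (by positivity))
    · exact (Finset.single_le_sum (f := fun s => |v s|) (fun _ _ => abs_nonneg _)
        (Finset.mem_univ s)).trans (le_add_of_nonneg_left (by positivity))
  have hbd : ∀ z w, pol.chain μ z w ≠ 0 → |imbalance u v w - imbalance u v z| ≤ 2 * M := by
    intro z w h
    obtain ⟨a, -, ha⟩ := pol.chain_ne_zero.1 h
    exact pol.abs_imbalance_step_le hM.1 hM.2 ha
  have hdrift : ∀ z, 0 ≤ drift (pol.chain μ) (imbalance u v) z := fun z =>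
    drift_bind_nonneg (b := fun a => u a.1 - v a.2) rfl
      (fun a w h => pol.abs_imbalance_step_le hM.1 hM.2 h)
      (fun a w h => pol.le_imbalance_step huv h) h0
  obtain ⟨z, hz⟩ := p.support_nonempty
  -- From a state charged by `p` the imbalance stays constant, so no possible arrival has positive
  -- weight; with a non-negative mean, all these weights vanish.
  have hle : ∀ a, μ a ≠ 0 → u a.1 - v a.2 ≤ 0 := fun a ha => by
    obtain ⟨w, hw⟩ := (pol.step z a).support_nonempty
    have h1 := eq_of_stationary_submartingale hp hbd hdrift hz (pol.chain_ne_zero.2 ⟨a, ha, hw⟩)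
    have h2 := pol.le_imbalance_step huv hw
    linarith
  have hterm : ∀ a, (μ a).toReal * (u a.1 - v a.2) ≤ 0 := fun a => by
    by_cases ha : μ a = 0
    · simp [ha]
    · exact mul_nonpos_of_nonneg_of_nonpos ENNReal.toReal_nonneg (hle a ha)
  have hzero : ∀ a, μ a ≠ 0 → u a.1 - v a.2 = 0 := fun a ha => by
    have h1 := (Finset.sum_eq_zero_iff_of_nonpos fun a _ => hterm a).1
      ((Finset.sum_nonpos fun a _ => hterm a).antisymm h0) a (Finset.mem_univ a)
    exact (mul_eq_zero.1 h1).resolve_left (ENNReal.toReal_ne_zero.2 ⟨ha, PMF.apply_ne_top _ _⟩)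
  refine not_isAttractive_of_monotone (f := imbalance u v) (fun z w h => ?_) hunb p hatt
  obtain ⟨a, ha, haw⟩ := pol.chain_ne_zero.1 h
  linarith [hzero a ha, pol.le_imbalance_step huv haw]

theorem exists_state_single {c : C} {s : S} (h : (c, s) ∉ E) (k : ℕ) :
    ∃ z : State E, ∀ u v, imbalance u v z = u c * k - v s * k := by
  classical
  refine ⟨⟨(Pi.single c k, Pi.single s k), by simp, fun d t hdt => ?_⟩, fun u v => ?_⟩
  · by_cases hd : d = c
    · have ht : t ≠ s := fun ht => h (hd ▸ ht ▸ hdt)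
      simp [ht]
    · simp [hd]
  · simp [imbalance, Pi.single_apply]

theorem sum_map_mul {A B : Type*} [Fintype A] [Fintype B] (μ : PMF A) (f : A → B)
    (g : B → ℝ≥0∞) : ∑ b, μ.map f b * g b = ∑ a, μ a * g (f a) := by
  have := expect_map μ f g
  simpa only [expect, tsum_fintype] using this

open Classical in
theorem sum_map_eq {A B : Type*} [Fintype A] [Fintype B] (μ : PMF A) (f : A → B)
    (T : Finset B) : ∑ b ∈ T, μ.map f b = ∑ a, if f a ∈ T then μ a else 0 := by
  have := sum_map_mul μ f fun b => if b ∈ T then 1 else 0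
  simpa only [mul_ite, mul_one, mul_zero, Finset.sum_ite_mem, Finset.univ_inter] using this

open Classical in
theorem sum_map_toReal {A B : Type*} [Fintype A] [Fintype B] (μ : PMF A) (f : A → B)
    (T : Finset B) : (∑ b ∈ T, μ.map f b).toReal = ∑ a, (μ a).toReal * if f a ∈ T then 1 else 0 := by
  rw [sum_map_eq, ENNReal.toReal_sum fun a _ => by split_ifs <;> simp [PMF.apply_ne_top]]
  simp only [mul_ite, mul_one, mul_zero, apply_ite ENNReal.toReal, ENNReal.toReal_zero]

theorem sum_lt_sum_univ {A : Type*} [Fintype A] {p : PMF A} (hp : p.support = Set.univ)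
    {U : Finset A} (hU : U ≠ Finset.univ) : ∑ a ∈ U, p a < 1 := by
  classical
  obtain ⟨a, ha⟩ : ∃ a, a ∉ U := by simpa [Finset.eq_univ_iff_forall] using hU
  have h1 : p a ≠ 0 := (p.mem_support_iff a).1 (hp ▸ Set.mem_univ a)
  have h2 : p a + ∑ a ∈ U, p a ≤ 1 := by
    rw [← Finset.sum_insert ha, ← p.tsum_coe]
    exact ENNReal.sum_le_tsum _
  have h3 : ∑ a ∈ U, p a ≠ ∞ := ne_top_of_le_ne_top ENNReal.one_ne_top (le_add_self.trans h2)
  calc ∑ a ∈ U, p a < ∑ a ∈ U, p a + p a := ENNReal.lt_add_right h3 h1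
    _ ≤ 1 := by rwa [add_comm]

theorem PMF_sum_univ {A : Type*} [Fintype A] (p : PMF A) : ∑ a, p a = 1 := by
  exact (tsum_fintype _).symm.trans p.tsum_coe

theorem Policy.ncond_of_isStable (pol : Policy E) {μ : PMF (C × S)} (hμ : HasFullMarginals μ)
    (hst : IsStable (pol.chain μ)) : NCond E (μ.map Prod.fst) (μ.map Prod.snd) := by
  classical
  refine ⟨fun U ⟨c, hc⟩ hU => ?_, fun V ⟨s, hs⟩ hV => ?_⟩
  · by_cases hSU : serversOf E U = Finset.univ
    · rw [hSU, PMF_sum_univ]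
      exact sum_lt_sum_univ hμ.1 hU
    · obtain ⟨s, hs⟩ : ∃ s, s ∉ serversOf E U := by
        simpa [Finset.eq_univ_iff_forall] using hSU
      have hcs : (c, s) ∉ E := fun h => hs (by simpa [serversOf] using ⟨c, hc, h⟩)
      -- With these weights, `k` customers `c` and `k` servers `s` form a state of imbalance `k`.
      have h := pol.mean_weight_neg_of_isStable hst (u := fun c => if c ∈ U then 1 else 0)
        (v := fun s => if s ∈ serversOf E U then 1 else 0) (fun c s hcs => ?_) (fun k => ?_)
      · simp only [mul_sub, Finset.sum_sub_distrib] at h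
        rw [← sum_map_toReal μ Prod.fst U, ← sum_map_toReal μ Prod.snd (serversOf E U)] at h
        rw [← ENNReal.toReal_lt_toReal (ENNReal.sum_ne_top.2 fun _ _ => PMF.apply_ne_top _ _)
          (ENNReal.sum_ne_top.2 fun _ _ => PMF.apply_ne_top _ _)]
        linarith
      · by_cases hc : c ∈ U
        · have : s ∈ serversOf E U := by simpa [serversOf] using ⟨c, hc, hcs⟩
          simp [hc, this]
        · simp only [hc, if_false]
          split_ifs <;> simp
      · obtain ⟨z, hz⟩ := exists_state_single hcs k
        exact ⟨z, by simp [hz, hc, hs]⟩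
  · by_cases hCV : customersOf E V = Finset.univ
    · rw [hCV, PMF_sum_univ]
      exact sum_lt_sum_univ hμ.2 hV
    · obtain ⟨c, hc⟩ : ∃ c, c ∉ customersOf E V := by
        simpa [Finset.eq_univ_iff_forall] using hCV
      have hcs : (c, s) ∉ E := fun h => hc (by simpa [customersOf] using ⟨s, hs, h⟩)
      -- The negative signs turn the condition on `V` into the same form: an edge into `V` starts in
      -- `C(V)`.
      have h := pol.mean_weight_neg_of_isStable hst
        (u := fun c => -if c ∈ customersOf E V then 1 else 0)
        (v := fun s => -if s ∈ V then 1 else 0) (fun c s hcs => ?_) (fun k => ?_)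
      · simp only [mul_sub, mul_neg, Finset.sum_sub_distrib, Finset.sum_neg_distrib] at h
        rw [← sum_map_toReal μ Prod.fst (customersOf E V), ← sum_map_toReal μ Prod.snd V] at h
        rw [← ENNReal.toReal_lt_toReal (ENNReal.sum_ne_top.2 fun _ _ => PMF.apply_ne_top _ _)
          (ENNReal.sum_ne_top.2 fun _ _ => PMF.apply_ne_top _ _)]
        linarith
      · by_cases hs : s ∈ V
        · have : c ∈ customersOf E V := by simpa [customersOf] using ⟨s, hs, hcs⟩
          simp [hs, this]
        · simp only [hs, if_false]
          split_ifs <;> simp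
      · obtain ⟨z, hz⟩ := exists_state_single hcs k
        exact ⟨z, by simp [hz, hc, hs]⟩

end Steps

/-! ### Neighbours -/

/-- The first edge of a walk to the other side gives a neighbour. Nothing else is used of
connectedness. -/
theorem exists_neighbours {C S : Type*} {E : Set (C × S)} [Nonempty C] [Nonempty S]
    (hE : (matchingGraph E).Connected) :
    (∀ c, ∃ s, (c, s) ∈ E) ∧ ∀ s, ∃ c, (c, s) ∈ E := by
  have key : ∀ a b : C ⊕ S, a ≠ b → ∃ d, (matchingGraph E).Adj a d := fun a b hab => by
    obtain ⟨p⟩ := hE.preconnected a b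
    cases p with
    | nil => exact absurd rfl hab
    | cons h _ => exact ⟨_, h⟩
  refine ⟨fun c => ?_, fun s => ?_⟩
  · obtain ⟨d, hd⟩ := key (Sum.inl c) (Sum.inr (Classical.arbitrary S)) (by simp)
    rw [matchingGraph, SimpleGraph.fromRel_adj] at hd
    obtain ⟨-, ⟨c', s, h, h1, -⟩ | ⟨c', s, -, -, h1⟩⟩ := hd
    · cases h1
      exact ⟨s, h⟩
    · cases h1
  · obtain ⟨d, hd⟩ := key (Sum.inr s) (Sum.inl (Classical.arbitrary C)) (by simp)
    rw [matchingGraph, SimpleGraph.fromRel_adj] at hd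
    obtain ⟨-, ⟨c', s, -, h1, -⟩ | ⟨c', s, h, -, h1⟩⟩ := hd
    · cases h1
    · cases h1
      exact ⟨c', h⟩

section Reach

variable {C S : Type*} [Fintype C] [Fintype S] {E : Set (C × S)}

/-! ### Reaching the empty buffer -/

/-- The empty buffer. -/
def emptyState (E : Set (C × S)) : State E := ⟨(0, 0), by simp⟩

theorem eq_emptyState {z : State E} (h : ∑ c, z.1.1 c = 0) : z = emptyState E := by
  have h' := z.2.1 ▸ h
  simp only [Finset.sum_eq_zero_iff, Finset.mem_univ, true_implies] at h h'
  exact Subtype.ext (Prod.ext (funext h) (funext h'))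

/-- The arriving server `s` certainly takes a customer. Either the arriving `d` also finds a match
and the buffer shrinks, or `d` stays and the servers are untouched. -/
theorem Policy.exists_step_of_available (pol : Policy E) {μ : PMF (C × S)} {z : State E}
    {c d : C} {s : S} (hc : 0 < z.1.1 c) (hcs : (c, s) ∈ E) (hd : μ (d, s) ≠ 0) :
    ∃ w : State E, Linked (pol.chain μ) z w ∧ (∑ c, w.1.1 c < ∑ c, z.1.1 c ∨
      0 < w.1.1 d ∧ w.1.2 = z.1.2) := by
  obtain ⟨w, hw⟩ := (pol.step z (d, s)).support_nonempty
  refine ⟨w, pol.chain_ne_zero.2 ⟨_, hd, hw⟩, ?_⟩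
  have hs : Nonempty (AvailableCustomers E z.1.1 s) := ⟨c, hcs, hc⟩
  rcases pol.step_cases hw with ⟨-, -, i, j, -, -, rfl⟩ | ⟨-, hc, i, -, rfl⟩ |
    ⟨-, hs', -⟩ | ⟨hs', -⟩ | ⟨-, hs', -⟩
  · left
    have := sum_removeOne z.1.1 i i.2.2
    simp only [State.removeBoth]
    omega
  · right
    simp [State.replaceCustomer, addOne_self]
  all_goals exact absurd hs hs'

theorem Policy.exists_reachable_of_path (pol : Policy E) {μ : PMF (C × S)} {z : State E} {c d : C}
    (hc : 0 < z.1.1 c)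
    (hd : Relation.ReflTransGen (fun c d => ∃ s, (c, s) ∈ E ∧ μ (d, s) ≠ 0) c d) :
    ∃ w : State E, Relation.ReflTransGen (Linked (pol.chain μ)) z w ∧
      (∑ c, w.1.1 c < ∑ c, z.1.1 c ∨ 0 < w.1.1 d ∧ w.1.2 = z.1.2) := by
  induction hd with
  | refl => exact ⟨z, .refl, Or.inr ⟨hc, rfl⟩⟩
  | tail _ hde ih =>
    obtain ⟨w, hzw, hw | ⟨hw, hy⟩⟩ := ih
    · exact ⟨w, hzw, Or.inl hw⟩
    · obtain ⟨s, hs, hμ⟩ := hde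
      obtain ⟨v, hwv, hv⟩ := pol.exists_step_of_available hw hs hμ
      refine ⟨v, hzw.tail hwv, ?_⟩
      -- The servers have not changed, so neither has the number of customers.
      have : ∑ c, w.1.1 c = ∑ c, z.1.1 c := by rw [w.2.1, z.2.1, hy]
      rwa [this, hy] at hv

/-- If the set `U` reachable from `c` were proper, every possible arrival with server in `S(U)`
would have its customer in `U`, so `μ_S(S(U)) ≤ μ_C(U)`, against NCond. -/
theorem reachable_of_ncond {μ : PMF (C × S)} (h : NCond E (μ.map Prod.fst) (μ.map Prod.snd))
    (c d : C) : Relation.ReflTransGen (fun c d => ∃ s, (c, s) ∈ E ∧ μ (d, s) ≠ 0) c d := by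
  classical
  set R := Relation.ReflTransGen fun c d : C => ∃ s, (c, s) ∈ E ∧ μ (d, s) ≠ 0 with hR
  let U : Finset C := {d | R c d}
  have hU : U = Finset.univ := by
    by_contra hne
    refine absurd (h.1 U ⟨c, by simp [U, hR, Relation.ReflTransGen.refl]⟩ hne) (not_lt.2 ?_)
    rw [sum_map_eq, sum_map_eq]
    refine Finset.sum_le_sum fun a _ => ?_
    split_ifs with h1 h2
    · exact le_rfl
    · by_contra! ha
      simp only [serversOf, Finset.mem_filter, Finset.mem_univ, true_and] at h1
      obtain ⟨e, he, hes⟩ := h1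
      refine h2 ?_
      simp only [U, Finset.mem_filter, Finset.mem_univ, true_and] at he ⊢
      exact he.tail ⟨a.2, hes, ha.ne'⟩
    · exact zero_le
    · exact le_rfl
  have : d ∈ U := hU ▸ Finset.mem_univ d
  simpa [U] using this

/-- A customer type `d` compatible with a waiting server `s` cannot be in the buffer while `s` is.
Following a path towards `d` must therefore shrink the buffer. -/
theorem Policy.reachable_emptyState (pol : Policy E) {μ : PMF (C × S)}
    (h : NCond E (μ.map Prod.fst) (μ.map Prod.snd)) (hE : ∀ s, ∃ c, (c, s) ∈ E) (z : State E) :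
    Relation.ReflTransGen (Linked (pol.chain μ)) z (emptyState E) := by
  induction hn : ∑ c, z.1.1 c using Nat.strong_induction_on generalizing z with
  | _ n ih =>
    rcases Nat.eq_zero_or_pos n with rfl | hpos
    · rw [eq_emptyState hn]
    · obtain ⟨c, hc⟩ : ∃ c, 0 < z.1.1 c := by
        by_contra! h0
        simp [Nat.le_zero.1 (h0 _)] at hn
        omega
      obtain ⟨s, hs⟩ : ∃ s, 0 < z.1.2 s := by
        by_contra! h0
        rw [z.2.1] at hn
        simp [Nat.le_zero.1 (h0 _)] at hn
        omega
      obtain ⟨d, hd⟩ := hE s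
      obtain ⟨w, hzw, hw | ⟨hw, hy⟩⟩ := pol.exists_reachable_of_path hc (reachable_of_ncond h c d)
      · exact hzw.trans (ih _ (hn ▸ hw) w rfl)
      · have := w.2.2 d s hd
        rw [hy] at this
        exact absurd this (Nat.mul_pos hw hs).ne'

end Reach

/-! ### The quadratic Lyapunov function -/

section Lyapunov

/-- Each gap is spread evenly over the elements of `U`; the minimum over the finitely many `U` works
for all. -/
theorem exists_slack {A B : Type*} [Fintype A] {p : A → ℝ≥0∞} {q : B → ℝ≥0∞}
    {T : Finset A → Finset B} (h : ∀ U : Finset A, U.Nonempty → U ≠ Finset.univ →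
      ∑ a ∈ U, p a < ∑ b ∈ T U, q b) :
    ∃ δ : ℝ≥0∞, δ ≠ 0 ∧ ∀ U, U ≠ Finset.univ → ∑ a ∈ U, (p a + δ) ≤ ∑ b ∈ T U, q b := by
  classical
  have hU : ∀ U : Finset A, ∃ δ : ℝ≥0∞, δ ≠ 0 ∧
      (U ≠ Finset.univ → ∑ a ∈ U, (p a + δ) ≤ ∑ b ∈ T U, q b) := fun U => by
    by_cases hne : U.Nonempty
    · by_cases huniv : U = Finset.univ
      · exact ⟨1, one_ne_zero, fun h => absurd huniv h⟩
      · have hlt := h U hne huniv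
        have hcard : (U.card : ℝ≥0∞) ≠ 0 := by simpa using hne.ne_empty
        refine ⟨(∑ b ∈ T U, q b - ∑ a ∈ U, p a) / U.card,
          ENNReal.div_ne_zero.2 ⟨(tsub_pos_of_lt hlt).ne', by simp⟩, fun _ => ?_⟩
        rw [Finset.sum_add_distrib, Finset.sum_const, nsmul_eq_mul,
          ENNReal.mul_div_cancel hcard (by simp), add_tsub_cancel_of_le hlt.le]
    · rw [Finset.not_nonempty_iff_eq_empty] at hne
      exact ⟨1, one_ne_zero, fun _ => by simp [hne]⟩
  choose d hd0 hd using hU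
  obtain ⟨U₀, -, hmin⟩ := Finset.exists_min_image (Finset.univ : Finset (Finset A)) d
    Finset.univ_nonempty
  refine ⟨d U₀, hd0 _, fun U hne => le_trans ?_ (hd U hne)⟩
  gcongr
  exact hmin U (Finset.mem_univ U)

open Classical in
/-- A comparison of weighted sums, from the comparison of the weights of all super-level sets. -/
theorem sum_mul_le_of_level_sets {A B : Type*} [Fintype A] [Fintype B] {R : A → B → Prop}
    {p : A → ℝ≥0∞} {q : B → ℝ≥0∞} (h : ∀ U : Finset A, U ≠ Finset.univ →
      ∑ a ∈ U, p a ≤ ∑ b ∈ ({b | ∃ a ∈ U, R a b} : Finset B), q b)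
    {x : A → ℕ} (hx : ∃ a, x a = 0) {m : B → ℕ} (hm : ∀ a b, R a b → x a ≤ m b) :
    ∑ a, p a * x a ≤ ∑ b, q b * m b := by
  set N := ∑ a, x a with hN
  have hxN : ∀ a, x a ≤ N := fun a => Finset.single_le_sum (fun _ _ => Nat.zero_le _)
    (Finset.mem_univ a)
  have hcount : ∀ n : ℕ, n ≤ N → (n : ℝ≥0∞) = ∑ k ∈ Finset.range N, if k < n then 1 else 0 := by
    intro n hn
    rw [Finset.sum_boole]
    congr 1
    have : {k ∈ Finset.range N | k < n} = Finset.range n := by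
      ext k
      simp only [Finset.mem_filter, Finset.mem_range]
      omega
    rw [this, Finset.card_range]
  -- The level set `{k < x}` is proper because `x` vanishes somewhere, and `m > k` at all its
  -- neighbours. Summing over `k` recovers the weights.
  have hlevel : ∀ k, ∑ a, p a * (if k < x a then 1 else 0) ≤
      ∑ b, q b * (if k < m b then 1 else 0) := fun k => by
    have h1 := h {a | k < x a} (fun hu => by
      obtain ⟨a, ha⟩ := hx
      have := Finset.eq_univ_iff_forall.1 hu a
      simp [ha] at this)
    rw [Finset.sum_filter, Finset.sum_filter] at h1
    simp only [mul_ite, mul_one, mul_zero]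
    refine h1.trans (Finset.sum_le_sum fun b _ => ?_)
    split_ifs with h2 h3
    · exact le_rfl
    · obtain ⟨a, ha, hab⟩ := h2
      simp only [Finset.mem_filter, Finset.mem_univ, true_and] at ha
      exact absurd (ha.trans_le (hm a b hab)) h3
    · exact zero_le
    · exact le_rfl
  calc ∑ a, p a * x a = ∑ k ∈ Finset.range N, ∑ a, p a * (if k < x a then 1 else 0) := by
        rw [Finset.sum_comm]
        refine Finset.sum_congr rfl fun a _ => ?_
        rw [← Finset.mul_sum, ← hcount _ (hxN a)]
    _ ≤ ∑ k ∈ Finset.range N, ∑ b, q b * (if k < m b then 1 else 0) :=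
        Finset.sum_le_sum fun k _ => hlevel k
    _ = ∑ b, q b * ∑ k ∈ Finset.range N, (if k < m b then 1 else 0) := by
        rw [Finset.sum_comm]
        simp only [Finset.mul_sum]
    -- Layers of `m` above `N` are discarded.
    _ ≤ ∑ b, q b * m b := by
        refine Finset.sum_le_sum fun b _ => mul_le_mul_right ?_ _
        rw [Finset.sum_boole]
        have h2 : {k ∈ Finset.range N | k < m b} ⊆ Finset.range (m b) := fun k => by simp
        exact_mod_cast (Finset.card_le_card h2).trans_eq (Finset.card_range _)

variable {C S : Type*} {E : Set (C × S)}

section CustomerQueues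

variable [Fintype C]

open Classical in
/-- The length of the longest queue of customers that can be matched with an `s`-server. -/
noncomputable def longestCustomerQueue (E : Set (C × S)) (x : C → ℕ) (s : S) : ℕ :=
  ({c | (c, s) ∈ E} : Finset C).sup x

theorem le_longestCustomerQueue (x : C → ℕ) {c : C} {s : S} (h : (c, s) ∈ E) :
    x c ≤ longestCustomerQueue E x s :=
  Finset.le_sup (f := x) (by simpa using h)

/-- Here, and in the server version, the choice made by ML enters. -/
theorem longestCustomerQueue_le [Fintype S] {x : C → ℕ} {s : S}
    {h : Nonempty (AvailableCustomers E x s)}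
    {i : AvailableCustomers E x s} (hi : (matchTheLongest E).Φ x s h i ≠ 0) :
    longestCustomerQueue E x s ≤ x i := by
  classical
  rw [← PMF.mem_support_iff] at hi
  simp only [matchTheLongest, PMF.mem_support_uniformOfFinset_iff, longestCustomers,
    Finset.mem_filter, Finset.mem_univ, true_and] at hi
  exact Finset.sup_le fun d hd => hi d (by simpa using hd)

theorem longestCustomerQueue_eq_zero {x : C → ℕ} {s : S}
    (h : ¬ Nonempty (AvailableCustomers E x s)) : longestCustomerQueue E x s = 0 := by
  classical
  simp only [nonempty_subtype, not_exists, not_and, not_lt] at h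
  exact Nat.le_zero.1 (Finset.sup_le fun d hd => h d (by simpa using hd))

end CustomerQueues

section ServerQueues

variable [Fintype S]

open Classical in
/-- The length of the longest queue of servers that can be matched with a `c`-customer. -/
noncomputable def longestServerQueue (E : Set (C × S)) (y : S → ℕ) (c : C) : ℕ :=
  ({s | (c, s) ∈ E} : Finset S).sup y

theorem le_longestServerQueue (y : S → ℕ) {c : C} {s : S} (h : (c, s) ∈ E) :
    y s ≤ longestServerQueue E y c :=
  Finset.le_sup (f := y) (by simpa using h)

theorem longestServerQueue_le [Fintype C] {y : S → ℕ} {c : C}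
    {h : Nonempty (AvailableServers E y c)}
    {j : AvailableServers E y c} (hj : (matchTheLongest E).Ψ y c h j ≠ 0) :
    longestServerQueue E y c ≤ y j := by
  classical
  rw [← PMF.mem_support_iff] at hj
  simp only [matchTheLongest, PMF.mem_support_uniformOfFinset_iff, longestServers,
    Finset.mem_filter, Finset.mem_univ, true_and] at hj
  exact Finset.sup_le fun t ht => hj t (by simpa using ht)

theorem longestServerQueue_eq_zero {y : S → ℕ} {c : C}
    (h : ¬ Nonempty (AvailableServers E y c)) : longestServerQueue E y c = 0 := by
  classical
  simp only [nonempty_subtype, not_exists, not_and, not_lt] at h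
  exact Nat.le_zero.1 (Finset.sup_le fun t ht => h t (by simpa using ht))

end ServerQueues

variable [Fintype C] [Fintype S]

/-- The sum of the squares of the queue lengths. -/
def energy (z : State E) : ℕ := ∑ c, z.1.1 c ^ 2 + ∑ s, z.1.2 s ^ 2

/-- Leaving a queue of length `l` lowers its square by `2 * l - 1`, and joining one raises it by `2
* l + 1`. When no match is available the longest queue is 0, so the bound loses nothing. -/
theorem energy_step_le {z w : State E} {a : C × S} (hw : (matchTheLongest E).step z a w ≠ 0) :
    energy w + 2 * (longestCustomerQueue E z.1.1 a.2 + longestServerQueue E z.1.2 a.1) ≤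
      energy z + 2 * (z.1.1 a.1 + z.1.2 a.2) + 2 := by
  rcases (matchTheLongest E).step_cases hw with ⟨hs, hc, i, j, hi, hj, rfl⟩ |
    ⟨hs, hc, i, hi, rfl⟩ | ⟨hc, hs, j, hj, rfl⟩ | ⟨hs, hc, ha, rfl⟩ | ⟨hE, hs, hc, rfl⟩
  · have h1 := sum_sq_removeOne z.1.1 i i.2.2
    have h2 := sum_sq_removeOne z.1.2 j j.2.2
    have h3 := longestCustomerQueue_le hi
    have h4 := longestServerQueue_le hj
    simp only [energy, State.removeBoth]
    omega
  · have h1 := sum_sq_addOne_removeOne_le z.1.1 i a.1 i.2.2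
    have h3 := longestCustomerQueue_le hi
    have h4 := longestServerQueue_eq_zero hc
    simp only [energy, State.replaceCustomer]
    omega
  · have h1 := sum_sq_addOne_removeOne_le z.1.2 j a.2 j.2.2
    have h3 := longestCustomerQueue_eq_zero hs
    have h4 := longestServerQueue_le hj
    simp only [energy, State.replaceServer]
    omega
  · have h3 := longestCustomerQueue_eq_zero hs
    have h4 := longestServerQueue_eq_zero hc
    omega
  · have h1 := sum_sq_addOne z.1.1 a.1
    have h2 := sum_sq_addOne z.1.2 a.2
    have h3 := longestCustomerQueue_eq_zero hs
    have h4 := longestServerQueue_eq_zero hc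
    simp only [energy, State.add]
    omega

/-- The number of individuals in the buffer. -/
def size (z : State E) : ℕ := ∑ c, z.1.1 c + ∑ s, z.1.2 s

theorem finite_size_lt (N : ℕ) : {z : State E | size z < N}.Finite := by
  classical
  refine Set.Finite.of_injOn (f := Subtype.val)
    (t := Set.Icc (0 : (C → ℕ) × (S → ℕ)) (fun _ => N, fun _ => N)) (fun z hz => ?_)
    Subtype.val_injective.injOn (Set.finite_Icc _ _)
  have hz' : ∑ c, z.1.1 c + ∑ s, z.1.2 s < N := hz
  refine ⟨⟨fun _ => Nat.zero_le _, fun _ => Nat.zero_le _⟩, fun c => ?_, fun s => ?_⟩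
  · have := Finset.single_le_sum (f := z.1.1) (fun _ _ => Nat.zero_le _) (Finset.mem_univ c)
    simp only
    omega
  · have := Finset.single_le_sum (f := z.1.2) (fun _ _ => Nat.zero_le _) (Finset.mem_univ s)
    simp only
    omega

/-- If all customer types were present, no server could wait, and the balance would empty the
buffer. So superlevel sets are proper and NCond applies to them. -/
theorem exists_customer_queue_eq_zero [Nonempty C] (hE : ∀ s, ∃ c, (c, s) ∈ E) (z : State E) :
    ∃ c, z.1.1 c = 0 := by
  by_contra! h
  have hy : ∀ s, z.1.2 s = 0 := fun s => by
    obtain ⟨c, hc⟩ := hE s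
    exact (mul_eq_zero.1 (z.2.2 c s hc)).resolve_left (h c)
  have h1 := z.2.1
  simp only [hy, Finset.sum_const_zero, Finset.sum_eq_zero_iff, Finset.mem_univ,
    true_implies] at h1
  exact h (Classical.arbitrary C) (h1 _)

theorem exists_server_queue_eq_zero [Nonempty S] (hE : ∀ c, ∃ s, (c, s) ∈ E) (z : State E) :
    ∃ s, z.1.2 s = 0 := by
  by_contra! h
  have hx : ∀ c, z.1.1 c = 0 := fun c => by
    obtain ⟨s, hs⟩ := hE c
    exact (mul_eq_zero.1 (z.2.2 c s hs)).resolve_right (h s)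
  have h1 := z.2.1.symm
  simp only [hx, Finset.sum_const_zero, Finset.sum_eq_zero_iff, Finset.mem_univ,
    true_implies] at h1
  exact h (Classical.arbitrary S) (h1 _)

theorem exists_energy_drift [Nonempty C] [Nonempty S] (hC : ∀ c, ∃ s, (c, s) ∈ E)
    (hS : ∀ s, ∃ c, (c, s) ∈ E) {μ : PMF (C × S)}
    (h : NCond E (μ.map Prod.fst) (μ.map Prod.snd)) :
    ∃ δ : ℝ≥0∞, δ ≠ 0 ∧ δ ≠ ∞ ∧ ∀ z : State E,
      expect ((matchTheLongest E).chain μ z) (fun w => energy w) + δ * size z ≤ energy z + 2 := by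
  classical
  obtain ⟨δ₁, hδ₁, h₁⟩ := exists_slack h.1
  obtain ⟨δ₂, hδ₂, h₂⟩ := exists_slack h.2
  -- The cap at 1 makes `δ` finite.
  set δ := min 1 (min δ₁ δ₂) with hδ
  have hδ0 : δ ≠ 0 := by
    simp only [hδ, ne_eq, ← nonpos_iff_eq_zero, min_le_iff, not_or]
    simp [hδ₁, hδ₂]
  have hδtop : δ ≠ ∞ := ne_top_of_le_ne_top ENNReal.one_ne_top (min_le_left _ _)
  refine ⟨2 * δ, mul_ne_zero two_ne_zero hδ0, ENNReal.mul_ne_top (by simp) hδtop, fun z => ?_⟩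
  set p := μ.map Prod.fst
  set q := μ.map Prod.snd
  set m := longestCustomerQueue E z.1.1
  set n := longestServerQueue E z.1.2
  have hx : ∑ c, (p c + δ) * z.1.1 c ≤ ∑ s, q s * m s := by
    refine sum_mul_le_of_level_sets (R := fun c s => (c, s) ∈ E) (fun U hU => ?_)
      (exists_customer_queue_eq_zero hS z) fun c s hcs => le_longestCustomerQueue _ hcs
    refine le_trans ?_ ((h₁ U hU).trans_eq ?_)
    · gcongr
      exact (min_le_right _ _).trans (min_le_left _ _)
    · rfl
  have hy : ∑ s, (q s + δ) * z.1.2 s ≤ ∑ c, p c * n c := by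
    refine sum_mul_le_of_level_sets (R := fun s c => (c, s) ∈ E) (fun V hV => ?_)
      (exists_server_queue_eq_zero hC z) fun s c hcs => le_longestServerQueue _ hcs
    refine le_trans ?_ ((h₂ V hV).trans_eq ?_)
    · gcongr
      exact (min_le_right _ _).trans (min_le_right _ _)
    · rfl
  set X : ℝ≥0∞ := ∑ c, p c * z.1.1 c with hX
  set Y : ℝ≥0∞ := ∑ s, q s * z.1.2 s with hY
  have hXtop : X ≠ ∞ := ENNReal.sum_ne_top.2 fun c _ =>
    ENNReal.mul_ne_top (PMF.apply_ne_top _ _) (by simp)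
  have hYtop : Y ≠ ∞ := ENNReal.sum_ne_top.2 fun c _ =>
    ENNReal.mul_ne_top (PMF.apply_ne_top _ _) (by simp)
  have hxs : X + δ * ∑ c, (z.1.1 c : ℝ≥0∞) ≤ ∑ s, q s * m s := by
    simpa only [add_mul, Finset.sum_add_distrib, ← Finset.mul_sum] using hx
  have hys : Y + δ * ∑ s, (z.1.2 s : ℝ≥0∞) ≤ ∑ c, p c * n c := by
    simpa only [add_mul, Finset.sum_add_distrib, ← Finset.mul_sum] using hy
  have hfst : ∀ g : C → ℝ≥0∞, expect μ (fun a => g a.1) = ∑ c, p c * g c := fun g => by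
    rw [sum_map_mul, expect, tsum_fintype]
  have hsnd : ∀ g : S → ℝ≥0∞, expect μ (fun a => g a.2) = ∑ s, q s * g s := fun g => by
    rw [sum_map_mul, expect, tsum_fintype]
  set EL := expect ((matchTheLongest E).chain μ z) fun w => (energy w : ℝ≥0∞) with hEL
  have hstep : EL + 2 * (∑ s, q s * m s + ∑ c, p c * n c) ≤ energy z + 2 * (X + Y) + 2 := by
    have h1 : EL + expect μ (fun a => 2 * ((m a.2 : ℝ≥0∞) + n a.1)) ≤
        expect μ fun a => energy z + 2 * ((z.1.1 a.1 : ℝ≥0∞) + z.1.2 a.2) + 2 := by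
      rw [hEL, Policy.chain, expect_bind, ← expect_add]
      refine expect_mono fun a _ => ?_
      rw [← expect_const ((matchTheLongest E).step z a) (2 * ((m a.2 : ℝ≥0∞) + n a.1)),
        ← expect_add, ← expect_const ((matchTheLongest E).step z a)
          (energy z + 2 * ((z.1.1 a.1 : ℝ≥0∞) + z.1.2 a.2) + 2)]
      refine expect_mono fun w hw => ?_
      exact_mod_cast energy_step_le hw
    simpa only [expect_add, expect_const_mul, expect_const, hfst fun c => (n c : ℝ≥0∞),
      hsnd fun s => (m s : ℝ≥0∞), hfst fun c => (z.1.1 c : ℝ≥0∞),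
      hsnd fun s => (z.1.2 s : ℝ≥0∞)] using h1
  -- The mean cost of arrivals is finite, so it can be added to both sides and cancelled.
  have hXY : 2 * (X + Y) ≠ ∞ := by finiteness
  refine (ENNReal.add_le_add_iff_right hXY).1 ?_
  calc EL + 2 * δ * size z + 2 * (X + Y)
      = EL + 2 * ((X + δ * ∑ c, (z.1.1 c : ℝ≥0∞)) + (Y + δ * ∑ s, (z.1.2 s : ℝ≥0∞))) := by
        simp only [size]
        push_cast
        ring
    _ ≤ EL + 2 * (∑ s, q s * m s + ∑ c, p c * n c) := by gcongr
    _ ≤ energy z + 2 * (X + Y) + 2 := hstep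
    _ = energy z + 2 + 2 * (X + Y) := by ring

end Lyapunov

end BipartiteMatching

open BipartiteMatching in
theorem mainTheorem1 {C S : Type*} [Fintype C] [Fintype S] [Nonempty C] [Nonempty S]
    (E : Set (C × S)) (hE : (BipartiteMatching.matchingGraph E).Connected) :
    (BipartiteMatching.matchTheLongest E).HasMaximalStabilityRegion := by
  obtain ⟨hC, hS⟩ := exists_neighbours hE
  ext μ
  refine ⟨fun h => ⟨h.1, (matchTheLongest E).ncond_of_isStable h.1 h.2⟩, fun h => ⟨h.1, ?_⟩⟩
  obtain ⟨δ, hδ, hδ', hdrift⟩ := exists_energy_drift hC hS h.2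
  exact isStable_of_tight ((matchTheLongest E).reachable_emptyState h.2 hS)
    (isTightSeq_of_drift hdrift hδ hδ' (by simp) (by simp) finite_size_lt)
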